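/- Let $\mathbb F_q$ be the finite field with $q$ elements, $A=\mathbb F_q[T]$, $r\ge 2$, let $g_1,\dots,g_{r-1}$ be independent variables over $\mathbb F_q(T)$, $K=\mathbb F_q(T,g_1,\dots,g_{r-1})$, and let $\varphi$ be the monic generic rank-$r$ Drinfeld $A$-module over $K$, $$\varphi_T(X)=TX+g_1X^q+\cdots+g_{r-1}X^{q^{r-1}}+X^{q^r}.$$ Let $e_1,\dots,e_r\ge 0$ be integers with $\sum_{i=1}^{r-1}e_i(q^i-1)=e_r(q^r-1)$, and let $J=g_1^{e_1}\cdots g_{r-1}^{e_{r-1}}\Delta^{-e_r}$ be the corresponding monomial isomorphism invariant; its value at a Drinfeld module $\phi_T(X)=TX+\ell_1X^q+\cdots+\ell_rX^{q^r}$ ($\ell_r\ne 0$) over an algebraic closure $\overline K$ of $K$ is $J(\phi)=\ell_1^{e_1}\cdots\ell_{r-1}^{e_{r-1}}\ell_r^{-e_r}$. For $1\le s\le r$, an isogeny $f:\varphi\to\varphi^{(f)}$ over $\overline K$ is of type $(A/TA)^s$ if $\ker f\subset\varphi[T]$ and, for some basis $\varphi[T]\cong(A/TA)^r$, $\ker f$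 corresponds to the submodule $(A/TA)^s\subset(A/TA)^r$ spanned by the first $s$ standard basis vectors. The Drinfeld modular polynomial is $$\Phi_{J,(A/TA)^s}(X)=\prod_{f}\bigl(X-J(\varphi^{(f)})\bigr),$$ the product being over the isogenies $f:\varphi\to\varphi^{(f)}$ of type $(A/TA)^s$ up to isomorphism of the target. Let $s=1$ or $s=r-1$, and put $\psi_r=(q^r-1)/(q-1)$, $$w_1(J)=q\Bigl(\sum_{i=1}^{r-1}e_i-e_r\Bigr),\qquad w_{r-1}(J)=\sum_{i=1}^{r-1}e_i+e_r\,(q^r-q^{r-1}-1)$$ (for $r=2$ the two expressions agree). Then $\Phi_{J,(A/TA)^s}(X)=\sum_{k=0}^{\psi_r}a_kX^k$ has coefficients $a_k\in A[g_1,\dots,g_{r-1}]$ and degree $\psi_r$, and $$a_0\neq 0,\qquad \deg_T a_0=\psi_r\,w_s(J),\qquad \deg_T a_k\le(\psi_r-k)\,w_s(J)\quad(0\le k\le\psi_r).$$ In particular the height (the largest $T$-degree of a coefficient) of $\Phi_{J,(A/TA)^s}$ equals $\psi_r\,w_s(J)$. -/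

import Mathlib

open Polynomial

noncomputable section

/-- A Drinfeld `𝔽_q[T]`-module of rank `r` over an `𝔽_q[T]`-field `L`, given by
`φ_T(X) = ℓ₀ X + ℓ₁ X^q + ⋯ + ℓ_r X^(q^r)` with `ℓ₀` the image of `T` and `ℓ_r ≠ 0`.
The polynomial variable of `Fq[X]` plays the role of `T`. -/
structure DrinfeldModule (Fq : Type*) [Field Fq] [Fintype Fq] (L : Type*) [Field L]
    [Algebra Fq[X] L] (r : ℕ) where
  /-- the coefficients `ℓ_i` -/
  coeff : ℕ → L
  coeff_zero : coeff 0 = algebraMap Fq[X] L X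
  coeff_rank : coeff r ≠ 0
  coeff_gt : ∀ i, r < i → coeff i = 0

namespace DrinfeldModule

section Basic

variable {Fq : Type*} [Field Fq] [Fintype Fq] {L : Type*} [Field L] [Algebra Fq[X] L] {r : ℕ}

/-- The polynomial `φ_T(X)`. -/
def poly (φ : DrinfeldModule Fq L r) : L[X] :=
  ∑ i ∈ Finset.range (r + 1), C (φ.coeff i) * X ^ (Fintype.card Fq ^ i)

/-- `u ∈ L^×` is an isomorphism `φ → ψ`, that is `u ∘ φ_T = ψ_T ∘ u`. -/
def IsIso (u : Lˣ) (φ ψ : DrinfeldModule Fq L r) : Prop :=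
  C (u : L) * φ.poly = ψ.poly.comp (C (u : L) * X)

/-- An isogeny `f : φ → φ^(f)` starting at `φ`: a Drinfeld module `φ^(f)` together with a nonzero
`q`-polynomial `f` such that `f ∘ φ_T = φ^(f)_T ∘ f`. -/
structure Isogeny (φ : DrinfeldModule Fq L r) where
  /-- the target `φ^(f)` -/
  target : DrinfeldModule Fq L r
  /-- the polynomial `f(X)` -/
  f : L[X]
  f_linear : ∀ n, f.coeff n ≠ 0 → ∃ i : ℕ, n = Fintype.card Fq ^ i
  f_ne_zero : f ≠ 0
  f_comm : f.comp φ.poly = target.poly.comp f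

/-- Isogenies starting at `φ` up to isomorphism: `f` and `f'` are identified when `f' = u ∘ f` for
an isomorphism `u` from the target of `f` to the target of `f'`. -/
def isogenySetoid (φ : DrinfeldModule Fq L r) : Setoid φ.Isogeny where
  r a b := ∃ u : Lˣ, IsIso u a.target b.target ∧ b.f = C (u : L) * a.f
  iseqv :=
    { refl := fun a => ⟨1, by simp [IsIso], by simp⟩
      symm := by
        rintro a b ⟨u, h1, h2⟩
        refine ⟨u⁻¹, ?_, ?_⟩
        · unfold IsIso at *
          have h3 := congrArg (fun p : L[X] => C ((u⁻¹ : Lˣ) : L) *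
            p.comp (C ((u⁻¹ : Lˣ) : L) * X)) h1
          simp only [mul_comp, comp_assoc, C_comp, X_comp] at h3
          rw [← mul_assoc, ← mul_assoc, ← C_mul, ← C_mul] at h3
          simpa using h3.symm
        · rw [h2, ← mul_assoc, ← C_mul]
          simp
      trans := by
        rintro a b c ⟨u, h1, h2⟩ ⟨v, h3, h4⟩
        refine ⟨v * u, ?_, ?_⟩
        · unfold IsIso at *
          have h5 := congrArg (fun p : L[X] => p.comp (C (u : L) * X)) h3
          simp only [mul_comp, comp_assoc, C_comp, X_comp] at h5
          rw [← h1, ← mul_assoc, ← mul_assoc, ← C_mul] at h5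
          rw [Units.val_mul, C_mul, mul_assoc, mul_assoc] at *
          exact h5
        · rw [h4, h2, ← mul_assoc, ← C_mul]
          simp }

/-- The value at `φ` of the monomial `g₁^(e 1) ⋯ g_(r-1)^(e (r-1)) Δ^(-(e r))`. -/
def evalMonomial (e : ℕ → ℕ) (φ : DrinfeldModule Fq L r) : L :=
  (∏ i ∈ Finset.Ico 1 r, φ.coeff i ^ e i) * (φ.coeff r ^ e r)⁻¹

end Basic

section Torsion

variable {Fq : Type*} [Field Fq] [Fintype Fq] {L : Type*} [Field L] [Algebra Fq[X] L]
  [Algebra Fq L] {r : ℕ}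

/-- The `𝔽_q`-linear map `x ↦ φ_T(x)` on `L`. -/
def linearMap (φ : DrinfeldModule Fq L r) : L →ₗ[Fq] L where
  toFun x := φ.poly.eval x
  map_add' x y := by
    have h : ∀ i : ℕ, (x + y) ^ Fintype.card Fq ^ i
        = x ^ Fintype.card Fq ^ i + y ^ Fintype.card Fq ^ i := by
      intro i
      induction i with
      | zero => simp
      | succ i ih =>
        rw [pow_succ, pow_mul, pow_mul, pow_mul, ih]
        exact map_add (FiniteField.frobeniusAlgHom Fq L) _ _
    simp [poly, eval_finsetSum, h, mul_add, Finset.sum_add_distrib]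
  map_smul' c x := by
    have h : ∀ i : ℕ, c ^ Fintype.card Fq ^ i = c := fun i => FiniteField.pow_card_pow i c
    simp [poly, eval_finsetSum, Finset.smul_sum, _root_.smul_pow, h]

/-- The `𝔽_q[T]`-module `L` on which `T` acts through `φ_T`. -/
abbrev Points (φ : DrinfeldModule Fq L r) : Type _ := Module.AEval' φ.linearMap

/-- The torsion module `φ[N]` (for `L` algebraically closed). -/
abbrev torsion (φ : DrinfeldModule Fq L r) (N : Fq[X]) : Submodule Fq[X] φ.Points :=
  Submodule.torsionBy Fq[X] φ.Points N

/-- The isogeny `f` (over an algebraically closed field of generic characteristic) is of type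
`H ⊆ (A/NA)^r`, where `A = 𝔽_q[T]`: its kernel is contained in `φ[N]`, and corresponds to `H` under
a suitable choice of basis `φ[N] ≃ (A/NA)^r`. As any two bases differ by an element of
`GL_r(A/NA)`, this says that the kernel is in the `GL_r(A/NA)`-orbit of `H`. -/
def Isogeny.IsOfType {φ : DrinfeldModule Fq L r} (N : Fq[X])
    (H : Submodule Fq[X] (Fin r → Fq[X] ⧸ Ideal.span {N})) (a : φ.Isogeny) : Prop :=
  ∃ b : φ.torsion N ≃ₗ[Fq[X]] (Fin r → Fq[X] ⧸ Ideal.span {N}),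
    ∀ x : L, a.f.eval x = 0 ↔
      ∃ hx : Module.AEval'.of φ.linearMap x ∈ φ.torsion N, b ⟨_, hx⟩ ∈ H

/-- The polynomial `∏_f (X - J(φ^(f)))`, the product being over all isogenies `f : φ → φ^(f)` of
type `H` up to isomorphism. -/
def modularPolynomial (φ : DrinfeldModule Fq L r) (J : DrinfeldModule Fq L r → L) (N : Fq[X])
    (H : Submodule Fq[X] (Fin r → Fq[X] ⧸ Ideal.span {N})) : L[X] :=
  ∏ᶠ (c : Quotient φ.isogenySetoid) (_ : c.out.IsOfType N H), (X - C (J c.out.target))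

end Torsion

/-- The submodule `(A/NA)^s` of `(A/NA)^r`, where `A = 𝔽_q[T]`: the vectors all of whose coordinates
after the first `s` vanish. -/
def standardSubmodule {Fq : Type*} [Field Fq] (N : Fq[X]) (r s : ℕ) :
    Submodule Fq[X] (Fin r → Fq[X] ⧸ Ideal.span {N}) where
  carrier := {v | ∀ i : Fin r, s ≤ (i : ℕ) → v i = 0}
  add_mem' := by
    intro v w hv hw i hi
    simp [hv i hi, hw i hi]
  zero_mem' := by
    intro i _
    rfl
  smul_mem' := by
    intro c v hv i hi
    simp [hv i hi]

/-- The ring `A[g₁, …, g_(r-1)]` with `A = 𝔽_q[T]`; the `i`-th variable is `g_(i+1)`. -/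
abbrev CoeffRing (Fq : Type*) [Field Fq] (r : ℕ) : Type _ := MvPolynomial (Fin (r - 1)) Fq[X]

/-- An algebraic closure of `K = 𝔽_q(T, g₁, …, g_(r-1))`. -/
abbrev GenericField (Fq : Type*) [Field Fq] (r : ℕ) : Type _ :=
  AlgebraicClosure (FractionRing (CoeffRing Fq r))

/-- The monic generic Drinfeld module
`φ_T(X) = T X + g₁ X^q + ⋯ + g_(r-1) X^(q^(r-1)) + X^(q^r)`. -/
def monicGeneric (Fq : Type*) [Field Fq] [Fintype Fq] (r : ℕ) (hr : 2 ≤ r) :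
    DrinfeldModule Fq (GenericField Fq r) r where
  coeff i :=
    if h0 : i = 0 then algebraMap Fq[X] (GenericField Fq r) X
    else if h : i < r then
      algebraMap (CoeffRing Fq r) (GenericField Fq r) (MvPolynomial.X ⟨i - 1, by omega⟩)
    else if i = r then 1 else 0
  coeff_zero := by simp
  coeff_rank := by
    have h : r ≠ 0 := by omega
    simp [h]
  coeff_gt := by
    intro i hi
    have h0 : i ≠ 0 := by omega
    have h1 : ¬ i < r := by omega
    have h2 : i ≠ r := by omega
    simp [h0, h1, h2]

/-- The degree in `T` of an element of `A[g₁, …, g_(r-1)]` (with value `0` at `0`). -/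
def degT {Fq : Type*} [Field Fq] {r : ℕ} (p : CoeffRing Fq r) : ℕ :=
  p.support.sup fun m => (p.coeff m).natDegree

/-- The height of a polynomial over `A[g₁, …, g_(r-1)]`: the largest `T`-degree of a
coefficient. -/
def height {Fq : Type*} [Field Fq] {r : ℕ} (P : (CoeffRing Fq r)[X]) : ℕ :=
  P.support.sup fun k => degT (P.coeff k)

/-- The weight `w_1(J) = q (e₁ + ⋯ + e_(r-1) - e_r)`. -/
def weightOne (q r : ℕ) (e : ℕ → ℕ) : ℤ :=
  q * ((∑ i ∈ Finset.Ico 1 r, (e i : ℤ)) - e r)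

/-- The weight `w_(r-1)(J) = e₁ + ⋯ + e_(r-1) + e_r (q^r - q^(r-1) - 1)`. -/
def weightCorank (q r : ℕ) (e : ℕ → ℕ) : ℤ :=
  (∑ i ∈ Finset.Ico 1 r, (e i : ℤ)) + e r * ((q : ℤ) ^ r - (q : ℤ) ^ (r - 1) - 1)

end DrinfeldModule

end

/-! Let t be the q-power Frobenius, so that q-polynomials compose as skew polynomials in t. Since
A/TA is the field F_q, the submodules of phi[T] are its F_q-subspaces, and two of equal size are
exchanged by a change of basis. Hence an isogeny has type (A/TA)^s as soon as its kernel lies in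
phi[T] and has q^s elements (`Isogeny.isOfType_X`).

For s = 1 the isogeny is t - z up to a scalar. Right division of phi_T by t - z has quotient sum
k_(i+1) t^i and remainder k_0, with k_i = g_i + k_(i+1) z^(q^i). So the isogenies are the roots z of
k_0, a separable polynomial of degree psi_r, and the target (t - z)(sum k_(i+1) t^i) has
coefficients k_i^q - z k_(i+1). For s = r - 1 one has phi_T = (t - c) f with f = sum E_(i+1) t^i
monic. In terms of y = 1/c this is a recursion for E_i whose end condition E_r = 1 is a separable
equation of degree psi_r, and the target f (t - c) has coefficients E_i - E_(i+1) c^(q^i). Both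
targets are monic, so J is a product of powers of these coefficients.

The product of the X - J over the roots is rational over K, being a resultant up to a constant. The
valuative criterion shows that each J is integral over the integrally closed ring A[g_1, ...,
g_(r-1)], so the coefficients lie in this ring.

For the degrees, extend deg_T to a (multiplicative) valuation v of the algebraic closure
(`exists_valuation_degT`). The relation T = -k_1 z, respectively T = -c E_1, forces v(z) > 1,
respectively v(c) > 1. Then one term dominates each recursion step, which determines the value of
every target coefficient (`valuation_target_descending`, `valuation_target_ascending_pow`). The
weight-zero condition on e turns the exponents into v(J) = v(T)^w for every isogeny
(`sum_mul_weightOne`, `sum_mul_weightCorank`). Since all psi_r roots have the same value, the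
constant term has degree exactly psi_r w and the ultrametric inequality bounds the other
coefficients (`exists_coeffRing_polynomial`). -/

noncomputable section

/-! ### `q`-polynomials -/

namespace Polynomial

/-- The `q`-polynomial `∑_{i < n} a_i X^(q^i)`. -/
def qPoly {R : Type*} [CommRing R] (q n : ℕ) (a : ℕ → R) : R[X] :=
  ∑ i ∈ Finset.range n, C (a i) * X ^ q ^ i

section General

variable {R : Type*} [CommRing R] {q : ℕ}

lemma coeff_qPoly (hq : 1 < q) (n : ℕ) (a : ℕ → R) (k : ℕ) :
    (qPoly q n a).coeff (q ^ k) = if k < n then a k else 0 := by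
  simp only [qPoly, finsetSum_coeff, coeff_C_mul, coeff_X_pow]
  simp [Nat.pow_right_injective hq |>.eq_iff]

lemma natDegree_qPoly_le (hq : 1 < q) (n : ℕ) (a : ℕ → R) :
    (qPoly q (n + 1) a).natDegree ≤ q ^ n := by
  refine natDegree_sum_le_of_forall_le _ _ fun i hi => ?_
  refine (natDegree_C_mul_X_pow_le _ _).trans (Nat.pow_le_pow_right hq.le ?_)
  simpa [Nat.lt_succ_iff] using hi

lemma natDegree_qPoly (hq : 1 < q) (n : ℕ) (a : ℕ → R) (ha : a n ≠ 0) :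
    (qPoly q (n + 1) a).natDegree = q ^ n := by
  refine le_antisymm (natDegree_qPoly_le hq n a) (le_natDegree_of_ne_zero ?_)
  simpa [coeff_qPoly hq] using ha

lemma qPoly_congr {n : ℕ} {a b : ℕ → R} (h : ∀ i < n, a i = b i) : qPoly q n a = qPoly q n b :=
  Finset.sum_congr rfl fun i hi => by rw [h i (Finset.mem_range.1 hi)]

lemma C_mul_qPoly (u : R) (n : ℕ) (a : ℕ → R) :
    C u * qPoly q n a = qPoly q n fun i => u * a i := by
  simp [qPoly, Finset.mul_sum, mul_assoc]

lemma qPoly_sub (n : ℕ) (a b : ℕ → R) :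
    qPoly q n a - qPoly q n b = qPoly q n fun i => a i - b i := by
  simp [qPoly, sub_mul, Finset.sum_sub_distrib]

lemma qPoly_succ (n : ℕ) (a : ℕ → R) :
    qPoly q (n + 1) a = qPoly q n a + C (a n) * X ^ q ^ n := by
  simp [qPoly, Finset.sum_range_succ]

lemma qPoly_succ' (n : ℕ) (a : ℕ → R) :
    qPoly q (n + 1) a = (∑ i ∈ Finset.range n, C (a (i + 1)) * X ^ q ^ (i + 1)) + C (a 0) * X := by
  simp [qPoly, Finset.sum_range_succ']

lemma qPoly_comp (n : ℕ) (a : ℕ → R) (f : R[X]) :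
    (qPoly q n a).comp f = ∑ i ∈ Finset.range n, C (a i) * f ^ q ^ i := by
  simp [qPoly, Polynomial.sum_comp]

lemma qPoly_comp_C_mul_X (n : ℕ) (a : ℕ → R) (u : R) :
    (qPoly q n a).comp (C u * X) = qPoly q n fun i => a i * u ^ q ^ i := by
  rw [qPoly_comp]
  simp [qPoly, mul_pow, mul_assoc]

/-- A polynomial whose exponents are powers of `q` is a `q`-polynomial. -/
lemma eq_qPoly (hq : 1 < q) {f : R[X]} (hf : ∀ n, f.coeff n ≠ 0 → ∃ i : ℕ, n = q ^ i) {n : ℕ}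
    (hn : f.natDegree < q ^ n) : f = qPoly q n fun i => f.coeff (q ^ i) := by
  ext m
  by_cases hm : ∃ i, m = q ^ i
  · obtain ⟨i, rfl⟩ := hm
    rw [coeff_qPoly hq]
    split_ifs with h
    · rfl
    · exact coeff_eq_zero_of_natDegree_lt
        (hn.trans_le (Nat.pow_le_pow_right hq.le (not_lt.1 h)))
  · have h1 : f.coeff m = 0 := by
      by_contra h
      exact hm (hf m h)
    rw [h1]
    simp only [qPoly, finsetSum_coeff, coeff_C_mul, coeff_X_pow]
    symm
    refine Finset.sum_eq_zero fun i _ => ?_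
    rw [if_neg fun h => hm ⟨i, h⟩, mul_zero]

lemma qPoly_coeff_exponent (n : ℕ) (a : ℕ → R) (m : ℕ) (h : (qPoly q n a).coeff m ≠ 0) :
    ∃ i : ℕ, m = q ^ i := by
  by_contra hm
  refine h ?_
  simp only [qPoly, finsetSum_coeff, coeff_C_mul, coeff_X_pow]
  refine Finset.sum_eq_zero fun i _ => ?_
  rw [if_neg fun h => hm ⟨i, h⟩, mul_zero]

lemma X_pow_sub_C_mul_X_eq_qPoly (z : R) :
    X ^ q - C z * X = qPoly q 2 fun i => if i = 0 then -z else 1 := by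
  simp [qPoly, Finset.sum_range_succ]
  ring

end General

section Frobenius

variable (Fq : Type*) [Field Fq] [Fintype Fq] {B : Type*} [CommRing B] [Algebra Fq B]

local notation "q" => Fintype.card Fq


lemma _root_.FiniteField.sum_pow_card {ι : Type*} (s : Finset ι) (f : ι → B) :
    (∑ i ∈ s, f i) ^ q = ∑ i ∈ s, f i ^ q :=
  map_sum (FiniteField.frobeniusAlgHom Fq B) f s

lemma _root_.FiniteField.sub_pow_card (x y : B) : (x - y) ^ q = x ^ q - y ^ q :=
  map_sub (FiniteField.frobeniusAlgHom Fq B) x y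

lemma _root_.FiniteField.sub_pow_card_pow (x y : B) (n : ℕ) :
    (x - y) ^ q ^ n = x ^ q ^ n - y ^ q ^ n := by
  induction n with
  | zero => simp
  | succ n ih => rw [pow_succ, pow_mul, ih, FiniteField.sub_pow_card Fq, ← pow_mul, ← pow_mul]

lemma _root_.FiniteField.sum_pow_card_pow {ι : Type*} (s : Finset ι) (f : ι → B) (n : ℕ) :
    (∑ i ∈ s, f i) ^ q ^ n = ∑ i ∈ s, f i ^ q ^ n := by
  induction n with
  | zero => simp
  | succ n ih =>
    rw [pow_succ, pow_mul, ih, FiniteField.sum_pow_card Fq]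
    exact Finset.sum_congr rfl fun i _ => by rw [← pow_mul]

lemma _root_.FiniteField.card_cast_eq_zero : ((q : ℕ) : B) = 0 := by
  rw [← map_natCast (algebraMap Fq B), Nat.cast_card_eq_zero, map_zero]

lemma qPoly_pow_card_pow (n : ℕ) (a : ℕ → B) (k : ℕ) :
    qPoly q n a ^ q ^ k = ∑ i ∈ Finset.range n, C (a i ^ q ^ k) * X ^ q ^ (i + k) := by
  rw [qPoly, FiniteField.sum_pow_card_pow Fq]
  refine Finset.sum_congr rfl fun i _ => ?_
  rw [mul_pow, ← C_pow, ← pow_mul, ← pow_add]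

lemma qPoly_pow_card (n : ℕ) (a : ℕ → B) :
    qPoly q n a ^ q = ∑ i ∈ Finset.range n, C (a i ^ q) * X ^ q ^ (i + 1) := by
  simpa using qPoly_pow_card_pow Fq n a 1

/-- `(X^q - z X) ∘ ∑ a_(i+1) X^(q^i)`, up to a correction if `a_0 ≠ 0`. -/
lemma X_pow_sub_C_mul_X_comp_qPoly (r : ℕ) (a : ℕ → B) (z : B) (h0 : a 0 = 0)
    (hr : a (r + 1) = 0) :
    (X ^ q - C z * X).comp (qPoly q r fun i => a (i + 1)) =
      qPoly q (r + 1) fun i => a i ^ q - z * a (i + 1) := by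
  have e1 : qPoly q (r + 1) (fun i => a i ^ q) = (qPoly q r fun i => a (i + 1)) ^ q := by
    rw [qPoly_succ', qPoly_pow_card, h0, zero_pow Fintype.card_ne_zero]
    simp
  have e2 : qPoly q (r + 1) (fun i => z * a (i + 1)) = C z * qPoly q r fun i => a (i + 1) := by
    rw [qPoly_succ, hr, C_mul_qPoly]
    simp
  rw [← qPoly_sub, e1, e2]
  simp

/-- This is right division by t - z: the quotient carries the shifted indices and a_0 is the
remainder. With a_0 = 0 it also gives the coefficients of the target f (t - c) in corank one. -/
lemma qPoly_comp_X_pow_sub_C_mul_X (r : ℕ) (a : ℕ → B) (z : B) (hr : a (r + 1) = 0) :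
    (qPoly q r fun i => a (i + 1)).comp (X ^ q - C z * X) + C (a 0) * X =
      qPoly q (r + 1) fun i => a i - a (i + 1) * z ^ q ^ i := by
  rw [← qPoly_sub, qPoly_succ', qPoly_succ r fun i => a (i + 1) * z ^ q ^ i, hr, qPoly_comp]
  simp only [zero_mul, C_0, add_zero]
  rw [add_sub_right_comm, qPoly, ← Finset.sum_sub_distrib]
  congr 1
  refine Finset.sum_congr rfl fun i _ => ?_
  rw [FiniteField.sub_pow_card_pow Fq, ← pow_mul, ← pow_succ', mul_pow, C_mul, ← C_pow]
  ring

lemma derivative_qPoly (n : ℕ) (a : ℕ → B) :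
    derivative (qPoly q (n + 1) a) = C (a 0) := by
  rw [qPoly_succ', derivative_add, derivative_sum, Finset.sum_eq_zero]
  · simp
  · intro i _
    rw [derivative_C_mul, derivative_X_pow, pow_succ q i]
    push_cast
    rw [FiniteField.card_cast_eq_zero Fq]
    simp


/-- The `𝔽_q`-linear map defined by a `q`-polynomial. -/
def qPolyMap (n : ℕ) (a : ℕ → B) : B →ₗ[Fq] B where
  toFun x := (qPoly q n a).eval x
  map_add' x y := by
    have h : ∀ i : ℕ, (x + y) ^ q ^ i = x ^ q ^ i + y ^ q ^ i := fun i => by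
      have := FiniteField.sub_pow_card_pow Fq (x + y) y i
      rw [add_sub_cancel_right] at this
      rw [this, sub_add_cancel]
    simp [qPoly, eval_finsetSum, h, mul_add, Finset.sum_add_distrib]
  map_smul' c x := by
    have h : ∀ i : ℕ, c ^ q ^ i = c := fun i => FiniteField.pow_card_pow i c
    simp [qPoly, eval_finsetSum, Finset.smul_sum, _root_.smul_pow, h]

variable {Fq} {L : Type*} [Field L] [Algebra Fq L]

/-- The skew multiplication rule (a t^i)(b t^j) = a b^(q^i) t^(i+j). -/
lemma coeff_qPoly_comp_qPoly (n m : ℕ) (a b : ℕ → L) (k : ℕ) :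
    ((qPoly q n a).comp (qPoly q m b)).coeff (q ^ k) =
      ∑ i ∈ Finset.range n, ∑ j ∈ Finset.range m, if j + i = k then a i * b j ^ q ^ i else 0 := by
  have hq : 1 < q := Fintype.one_lt_card
  rw [qPoly_comp, finsetSum_coeff]
  refine Finset.sum_congr rfl fun i _ => ?_
  rw [coeff_C_mul, qPoly_pow_card_pow, finsetSum_coeff, Finset.mul_sum]
  refine Finset.sum_congr rfl fun j _ => ?_
  rw [coeff_C_mul, coeff_X_pow]
  simp [Nat.pow_right_injective hq |>.eq_iff, eq_comm]

/-- The number of roots of a separable polynomial over an algebraically closed field. -/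
lemma Separable.natCard_roots {K : Type*} [Field K] [IsAlgClosed K] {f : K[X]}
    (hf : f.Separable) : Nat.card {x // f.eval x = 0} = f.natDegree := by
  classical
  have h1 := card_rootSet_eq_natDegree (K := K) hf (IsAlgClosed.splits _)
  rw [← h1, ← Nat.card_eq_fintype_card]
  refine Nat.card_congr (Equiv.subtypeEquivRight fun x => ?_)
  rw [mem_rootSet]
  simp [hf.ne_zero]

/-- As q = 0 in L, differentiation leaves only the linear coefficient, here a nonzero constant. -/
lemma separable_qPoly {n : ℕ} {a : ℕ → L} (h : a 0 ≠ 0) :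
    (qPoly q (n + 1) a).Separable := by
  rw [Separable, derivative_qPoly]
  exact (isCoprime_one_right).of_isCoprime_of_dvd_right
    (isUnit_iff_dvd_one.1 (isUnit_C.2 h.isUnit))

lemma natCard_roots_qPoly [IsAlgClosed L] {n : ℕ} {a : ℕ → L} (h0 : a 0 ≠ 0)
    (hn : a n ≠ 0) : Nat.card {x // (qPoly q (n + 1) a).eval x = 0} = q ^ n := by
  rw [(separable_qPoly h0).natCard_roots, natDegree_qPoly Fintype.one_lt_card _ _ hn]

end Frobenius

end Polynomial

/-! ### Isogenies up to isomorphism of the target -/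

namespace DrinfeldModule

variable {Fq : Type*} [Field Fq] [Fintype Fq] {L : Type*} [Field L] [Algebra Fq[X] L] {r : ℕ}

local notation "q" => Fintype.card Fq

lemma poly_eq_qPoly (φ : DrinfeldModule Fq L r) : φ.poly = qPoly q (r + 1) φ.coeff := rfl

lemma isIso_iff (u : Lˣ) (φ ψ : DrinfeldModule Fq L r) :
    IsIso u φ ψ ↔ ∀ i ≤ r, (u : L) * φ.coeff i = ψ.coeff i * (u : L) ^ q ^ i := by
  have hq : 1 < q := Fintype.one_lt_card
  rw [IsIso, poly_eq_qPoly, poly_eq_qPoly, C_mul_qPoly, qPoly_comp_C_mul_X]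
  refine ⟨fun h i hi => ?_, fun h => qPoly_congr fun i hi => h i (by omega)⟩
  have := congrArg (fun p => p.coeff (q ^ i)) h
  simpa [coeff_qPoly hq, Nat.lt_succ_iff, hi] using this

/-- A monomial of weight zero is an isomorphism invariant. -/
lemma evalMonomial_eq_of_isIso {e : ℕ → ℕ}
    (he : ∑ i ∈ Finset.Ico 1 r, e i * (q ^ i - 1) = e r * (q ^ r - 1)) {u : Lˣ}
    {φ ψ : DrinfeldModule Fq L r} (h : IsIso u φ ψ) :
    evalMonomial e φ = evalMonomial e ψ := by
  have key : ∀ i ≤ r, φ.coeff i = ψ.coeff i * (u : L) ^ (q ^ i - 1) := by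
    intro i hi
    have h1 := (isIso_iff u φ ψ).1 h i hi
    have h2 : q ^ i = (q ^ i - 1) + 1 := (Nat.sub_add_cancel (Nat.one_le_pow _ _
      Fintype.card_pos)).symm
    rw [h2, pow_succ, ← mul_assoc, mul_comm (u : L)] at h1
    exact mul_right_cancel₀ u.ne_zero h1
  have hprod : ∏ i ∈ Finset.Ico 1 r, φ.coeff i ^ e i =
      (∏ i ∈ Finset.Ico 1 r, ψ.coeff i ^ e i) * (u : L) ^ (e r * (q ^ r - 1)) := by
    rw [← he, ← Finset.prod_pow_eq_pow_sum, ← Finset.prod_mul_distrib]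
    refine Finset.prod_congr rfl fun i hi => ?_
    rw [key i (Finset.mem_Ico.1 hi).2.le, mul_pow, ← pow_mul, mul_comm (e i)]
  have hu : (u : L) ^ (e r * (q ^ r - 1)) ≠ 0 := pow_ne_zero _ u.ne_zero
  have hψ := pow_ne_zero (e r) ψ.coeff_rank
  rw [evalMonomial, evalMonomial, hprod, key r le_rfl, mul_pow, ← pow_mul,
    mul_comm (q ^ r - 1) (e r)]
  field_simp

/-- The target of an isogeny `f` is determined by `f`. -/
lemma Isogeny.isIso_target {φ : DrinfeldModule Fq L r} (a b : φ.Isogeny) (u : Lˣ)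
    (h : b.f = C (u : L) * a.f) (ha : a.f.natDegree ≠ 0) : IsIso u a.target b.target := by
  have h1 : (C (u : L) * a.target.poly).comp a.f =
      (b.target.poly.comp (C (u : L) * X)).comp a.f := by
    rw [mul_comp, C_comp, ← a.f_comm, comp_assoc, mul_comp, C_comp, X_comp, ← h, ← b.f_comm, h,
      mul_comp, C_comp]
  rw [IsIso, ← sub_eq_zero]
  -- Right cancellation of f: a composite g ∘ f vanishes only if g = 0 or f is constant.
  have h2 := sub_eq_zero.2 h1
  rw [← sub_comp, comp_eq_zero_iff] at h2
  refine h2.resolve_right fun h3 => ha ?_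
  rw [h3.2, natDegree_C]

lemma Isogeny.rel_of_eq_C_mul {φ : DrinfeldModule Fq L r} (a b : φ.Isogeny) (u : Lˣ)
    (h : b.f = C (u : L) * a.f) (ha : a.f.natDegree ≠ 0) : φ.isogenySetoid a b :=
  ⟨u, a.isIso_target b u h ha, h⟩

variable [Algebra Fq L]

lemma Isogeny.isOfType_congr {φ : DrinfeldModule Fq L r} {a b : φ.Isogeny}
    (h : φ.isogenySetoid a b) (N : Fq[X]) (H : Submodule Fq[X] (Fin r → Fq[X] ⧸ Ideal.span {N})) :
    a.IsOfType N H ↔ b.IsOfType N H := by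
  obtain ⟨u, -, h⟩ := h
  have : ∀ x, b.f.eval x = 0 ↔ a.f.eval x = 0 := fun x => by simp [h]
  simp only [IsOfType, this]

/-- The modular polynomial computed from a system of representatives of the isogenies of
type `H`. -/
lemma modularPolynomial_eq_prod (φ : DrinfeldModule Fq L r) {e : ℕ → ℕ}
    (he : ∑ i ∈ Finset.Ico 1 r, e i * (q ^ i - 1) = e r * (q ^ r - 1)) (N : Fq[X])
    (H : Submodule Fq[X] (Fin r → Fq[X] ⧸ Ideal.span {N})) (Z : Finset L) (I : Z → φ.Isogeny)
    (j : L → L) (hj : ∀ z, evalMonomial e (I z).target = j z)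
    (hI : ∀ z, (I z).IsOfType N H) (hinj : ∀ z z', φ.isogenySetoid (I z) (I z') → z = z')
    (hsurj : ∀ a : φ.Isogeny, a.IsOfType N H → ∃ z, φ.isogenySetoid (I z) a) :
    φ.modularPolynomial (evalMonomial e) N H = ∏ z ∈ Z, (X - C (j z)) := by
  classical
  let m : Z → Quotient φ.isogenySetoid := fun z => ⟦I z⟧
  have hout : ∀ c : Quotient φ.isogenySetoid, φ.isogenySetoid c.out c.out :=
    fun c => φ.isogenySetoid.refl _
  have hm : Function.Injective m := fun z z' h => hinj z z' (Quotient.exact h)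
  have hmout : ∀ z, φ.isogenySetoid (I z) (m z).out := fun z =>
    Quotient.exact (Quotient.out_eq (m z)).symm
  have hset : ∀ c : Quotient φ.isogenySetoid, c.out.IsOfType N H ↔
      c ∈ Finset.univ.image m := by
    intro c
    simp only [Finset.mem_image, Finset.mem_univ, true_and]
    constructor
    · intro hc
      obtain ⟨z, hz⟩ := hsurj _ hc
      exact ⟨z, (Quotient.sound hz).trans (Quotient.out_eq c)⟩
    · rintro ⟨z, rfl⟩
      exact (Isogeny.isOfType_congr (hmout z) N H).1 (hI z)
  rw [modularPolynomial]
  simp only [hset]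
  have h1 := finprod_mem_coe_finset
    (fun c : Quotient φ.isogenySetoid => X - C (evalMonomial e c.out.target)) (Finset.univ.image m)
  simp only [Finset.mem_coe] at h1
  rw [h1, Finset.prod_image (fun z _ z' _ h => hm h), ← Finset.prod_coe_sort Z]
  refine Finset.prod_congr rfl fun z _ => ?_
  -- The representative `c.out` is only equivalent to `I z`; invariance of J under isomorphism
  -- removes the ambiguity.
  obtain ⟨u, hu, -⟩ := hmout z
  rw [← hj z, evalMonomial_eq_of_isIso he hu]

end DrinfeldModule

/-! ### Types of isogenies -/

section LinearAlgebra

lemma Module.finrank_eq_of_natCard_eq (K : Type*) {M N : Type*} [Field K] [Finite K]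
    [AddCommGroup M] [Module K M] [AddCommGroup N] [Module K N] [Finite M] [Finite N]
    (h : Nat.card M = Nat.card N) : Module.finrank K M = Module.finrank K N := by
  rw [Module.natCard_eq_pow_finrank (K := K), Module.natCard_eq_pow_finrank (K := K) (V := N)] at h
  exact Nat.pow_right_injective (Finite.one_lt_card (α := K)) h

/-- Two subspaces of the same cardinality correspond to each other under an isomorphism. -/
lemma Submodule.exists_linearEquiv_mem_iff {K M N : Type*} [Field K] [Finite K]
    [AddCommGroup M] [Module K M] [AddCommGroup N] [Module K N] [Finite M] [Finite N]
    (h : Nat.card M = Nat.card N) (P : Submodule K M) (Q : Submodule K N)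
    (hPQ : Nat.card P = Nat.card Q) : ∃ b : M ≃ₗ[K] N, ∀ x, b x ∈ Q ↔ x ∈ P := by
  obtain ⟨P', hP⟩ := P.exists_isCompl
  obtain ⟨Q', hQ⟩ := Q.exists_isCompl
  have e1 := Module.finrank_eq_of_natCard_eq K h
  have e2 := Module.finrank_eq_of_natCard_eq K hPQ
  have e3 : Module.finrank K P' = Module.finrank K Q' := by
    have h1 := Submodule.finrank_add_eq_of_isCompl hP
    have h2 := Submodule.finrank_add_eq_of_isCompl hQ
    omega
  let f := LinearEquiv.ofFinrankEq P Q e2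
  let g := LinearEquiv.ofFinrankEq P' Q' e3
  refine ⟨(Submodule.prodEquivOfIsCompl P P' hP).symm ≪≫ₗ (f.prodCongr g) ≪≫ₗ
    Submodule.prodEquivOfIsCompl Q Q' hQ, fun x => ?_⟩
  obtain ⟨⟨u, v⟩, rfl⟩ := (Submodule.prodEquivOfIsCompl P P' hP).surjective x
  rw [LinearEquiv.trans_apply, LinearEquiv.trans_apply, LinearEquiv.symm_apply_apply,
    LinearEquiv.prodCongr_apply, Submodule.coe_prodEquivOfIsCompl',
    Submodule.coe_prodEquivOfIsCompl']
  dsimp only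
  rw [Submodule.add_mem_iff_right _ (f u).2, Submodule.add_mem_iff_right _ u.2]
  constructor
  · intro hv
    have : ((g v : Q') : N) = 0 := Submodule.disjoint_def.1 hQ.disjoint _ hv (g v).2
    have : v = 0 := by simpa using this
    simp [this]
  · intro hv
    have : v = 0 := by
      ext
      exact Submodule.disjoint_def.1 hP.disjoint _ hv v.2
    simp [this]

/-- A module killed by X is just a vector space over K, so K-linear isomorphisms between such
modules are automatically K[X]-linear. -/
lemma Polynomial.smul_eq_coeff_zero_smul {K M : Type*} [Field K] [AddCommGroup M] [Module K M]
    [Module K[X] M] [IsScalarTower K K[X] M] (h : ∀ m : M, (X : K[X]) • m = 0) (p : K[X]) (m : M) :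
    p • m = p.coeff 0 • m := by
  conv_lhs => rw [← divX_mul_X_add p]
  rw [add_smul, mul_smul, h, smul_zero, zero_add, ← algebraMap_eq, algebraMap_smul]

lemma Polynomial.exists_linearEquiv_mem_iff {K M N : Type*} [Field K] [Finite K]
    [AddCommGroup M] [Module K M] [Module K[X] M] [IsScalarTower K K[X] M]
    [AddCommGroup N] [Module K N] [Module K[X] N] [IsScalarTower K K[X] N] [Finite M] [Finite N]
    (hM : ∀ m : M, (X : K[X]) • m = 0) (hN : ∀ m : N, (X : K[X]) • m = 0)
    (h : Nat.card M = Nat.card N) (P : Submodule K M) (Q : Submodule K N)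
    (hPQ : Nat.card P = Nat.card Q) : ∃ b : M ≃ₗ[K[X]] N, ∀ x, b x ∈ Q ↔ x ∈ P := by
  obtain ⟨b, hb⟩ := Submodule.exists_linearEquiv_mem_iff h P Q hPQ
  refine ⟨{ b with map_smul' := fun p m => ?_ }, hb⟩
  change b (p • m) = p • b m
  rw [smul_eq_coeff_zero_smul hM, smul_eq_coeff_zero_smul hN, map_smul]

lemma Polynomial.X_smul_fun_quotient (K ι : Type*) [Field K]
    (m : ι → K[X] ⧸ Ideal.span {(X : K[X])}) : (X : K[X]) • m = 0 := by
  ext i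
  obtain ⟨p, hp⟩ := Ideal.Quotient.mk_surjective (m i)
  change (X : K[X]) • m i = 0
  rw [← hp]
  refine (Ideal.Quotient.eq_zero_iff_mem (a := X * p)).2 ?_
  exact Ideal.mul_mem_right _ _ (Ideal.mem_span_singleton_self _)

end LinearAlgebra

namespace DrinfeldModule

lemma natCard_quotient_X (Fq : Type*) [Field Fq] :
    Nat.card (Fq[X] ⧸ Ideal.span {(X : Fq[X])}) = Nat.card Fq := by
  have e := quotientSpanXSubCAlgEquiv (0 : Fq)
  rw [C_0, sub_zero] at e
  exact Nat.card_congr e.toEquiv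

lemma natCard_standardSubmodule (Fq : Type*) [Field Fq] {r s : ℕ} (hs : s ≤ r) :
    Nat.card (standardSubmodule (X : Fq[X]) r s) = Nat.card Fq ^ s := by
  let F := Fq[X] ⧸ Ideal.span {(X : Fq[X])}
  let e : standardSubmodule (X : Fq[X]) r s ≃ (Fin s → F) :=
    { toFun := fun v i => v.1 (Fin.castLE hs i)
      invFun := fun w => ⟨fun i => if h : (i : ℕ) < s then w ⟨i, h⟩ else 0, by
        intro i hi
        simp [not_lt.2 hi]⟩
      left_inv := by
        rintro ⟨v, hv⟩
        ext i
        by_cases h : (i : ℕ) < s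
        · simp [h]
        · simp [h, hv i (not_lt.1 h)]
      right_inv := by
        intro w
        ext i
        simp }
  rw [Nat.card_congr e, Nat.card_fun, Nat.card_fin, natCard_quotient_X]

variable {Fq : Type*} [Field Fq] [Fintype Fq] {L : Type*} [Field L] [Algebra Fq[X] L]
  {r : ℕ}

local notation "q" => Fintype.card Fq

section Separable

variable [Algebra Fq L]

/-- In generic characteristic every isogeny is separable. -/
lemma Isogeny.coeff_one_ne_zero (hinj : Function.Injective (algebraMap Fq[X] L))
    {φ : DrinfeldModule Fq L r} (a : φ.Isogeny) : a.f.coeff 1 ≠ 0 := by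
  classical
  have hq : 1 < q := Fintype.one_lt_card
  have hex : ∃ k, a.f.coeff (q ^ k) ≠ 0 := by
    obtain ⟨k, hk⟩ := a.f_linear a.f.natDegree (by simpa using a.f_ne_zero)
    exact ⟨k, by rw [← hk]; simpa using a.f_ne_zero⟩
  set k := Nat.find hex with hkdef
  have hk : a.f.coeff (q ^ k) ≠ 0 := Nat.find_spec hex
  have hlt : ∀ i < k, a.f.coeff (q ^ i) = 0 := fun i hi => by
    by_contra h
    exact Nat.find_min hex hi h
  obtain ⟨n, hn⟩ : ∃ n, a.f.natDegree < q ^ n := ⟨_, Nat.lt_pow_self hq⟩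
  have hkn : k < n := by
    refine (Nat.pow_lt_pow_iff_right hq).1 (lt_of_le_of_lt ?_ hn)
    exact le_natDegree_of_ne_zero hk
  have hf := eq_qPoly hq a.f_linear hn
  set α : ℕ → L := fun i => a.f.coeff (q ^ i) with hα
  -- If X^(q^k) is the lowest monomial of f, its coefficient on both sides of the commutation
  -- relation gives T^(q^k) = T in L. Injectivity of F_q[T] → L then leaves only k = 0.
  have h1 := congrArg (fun p => p.coeff (q ^ k)) a.f_comm
  rw [hf, poly_eq_qPoly, poly_eq_qPoly] at h1
  simp only [coeff_qPoly_comp_qPoly] at h1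
  rw [Finset.sum_eq_single_of_mem k (Finset.mem_range.2 hkn),
    Finset.sum_eq_single_of_mem 0 (by simp), Finset.sum_eq_single_of_mem 0 (by simp),
    Finset.sum_eq_single_of_mem k (Finset.mem_range.2 hkn)] at h1
  · simp only [zero_add, add_zero, if_true, coeff_zero, pow_zero, pow_one] at h1
    rw [mul_comm] at h1
    have h2 := mul_right_cancel₀ (b := α k) hk h1
    rw [← map_pow] at h2
    have h3 := congrArg natDegree (hinj h2)
    rw [natDegree_X_pow, natDegree_X] at h3
    have h4 : k = 0 := by
      by_contra h
      exact (Nat.one_lt_pow h hq).ne' h3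
    simpa [h4] using hk
  · intro i _ hi
    rw [if_neg (by omega)]
  · intro j _ hj
    refine Finset.sum_eq_zero fun i _ => ?_
    split_ifs with h
    · rw [show α i = 0 from hlt i (by omega), zero_pow (by positivity), mul_zero]
    · rfl
  · intro j _ hj
    rw [if_neg (by omega)]
  · intro i _ hi
    refine Finset.sum_eq_zero fun j _ => ?_
    split_ifs with h
    · rw [show α i = 0 from hlt i (by omega), zero_mul]
    · rfl

lemma natCard_roots_poly [IsAlgClosed L] (hinj : Function.Injective (algebraMap Fq[X] L))
    (φ : DrinfeldModule Fq L r) : Nat.card {x // φ.poly.eval x = 0} = q ^ r := by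
  refine natCard_roots_qPoly ?_ φ.coeff_rank
  rw [φ.coeff_zero]
  exact (map_ne_zero_iff _ hinj).2 X_ne_zero

lemma Isogeny.natDegree_eq_of_natCard [IsAlgClosed L]
    (hinj : Function.Injective (algebraMap Fq[X] L)) {φ : DrinfeldModule Fq L r} (a : φ.Isogeny)
    {s : ℕ} (h : Nat.card {x // a.f.eval x = 0} = q ^ s) : a.f.natDegree = q ^ s := by
  have hq : 1 < q := Fintype.one_lt_card
  obtain ⟨n, hn⟩ : ∃ n, a.f.natDegree < q ^ n := ⟨_, Nat.lt_pow_self hq⟩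
  have hf := eq_qPoly hq a.f_linear (hn.trans_le (Nat.pow_le_pow_right hq.le n.le_succ))
  rw [← h, Separable.natCard_roots]
  rw [hf]
  refine separable_qPoly ?_
  simpa using a.coeff_one_ne_zero hinj

end Separable

section Types

variable [Algebra Fq L]

lemma mem_torsion_X_iff (φ : DrinfeldModule Fq L r) (x : L) :
    Module.AEval'.of φ.linearMap x ∈ φ.torsion X ↔ φ.poly.eval x = 0 := by
  rw [torsion, Submodule.mem_torsionBy_iff, Module.AEval'.X_smul_of,
    LinearEquiv.map_eq_zero_iff]
  rfl

lemma natCard_torsion_X [IsAlgClosed L] (hinj : Function.Injective (algebraMap Fq[X] L))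
    (φ : DrinfeldModule Fq L r) : Nat.card (φ.torsion X) = q ^ r := by
  rw [← natCard_roots_poly hinj φ]
  refine Nat.card_congr (Equiv.subtypeEquiv (Module.AEval'.of φ.linearMap).symm.toEquiv
    fun x => ?_)
  rw [← mem_torsion_X_iff]
  rfl

/-- The kernel of an isogeny, as a subspace of `φ[T]`. -/
lemma Isogeny.exists_submodule_mem_iff {φ : DrinfeldModule Fq L r} (a : φ.Isogeny) :
    ∃ P : Submodule Fq (φ.torsion X), ∀ x hx,
      (⟨Module.AEval'.of φ.linearMap x, hx⟩ : φ.torsion X) ∈ P ↔ a.f.eval x = 0 := by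
  have hq : 1 < q := Fintype.one_lt_card
  obtain ⟨n, hn⟩ : ∃ n, a.f.natDegree < q ^ n := ⟨_, Nat.lt_pow_self hq⟩
  have hf := eq_qPoly hq a.f_linear hn
  set α : ℕ → L := fun i => a.f.coeff (q ^ i)
  rw [hf]
  exact ⟨LinearMap.ker (qPolyMap Fq n α ∘ₗ (Module.AEval'.of φ.linearMap).symm.toLinearMap ∘ₗ
      (φ.torsion X).subtype.restrictScalars Fq), fun x hx => Iff.rfl⟩

lemma natCard_submodule_torsion_X {φ : DrinfeldModule Fq L r} {f : L[X]}
    (P : Submodule Fq (φ.torsion X)) (hP : ∀ x hx,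
      (⟨Module.AEval'.of φ.linearMap x, hx⟩ : φ.torsion X) ∈ P ↔ f.eval x = 0)
    (hker : ∀ x, f.eval x = 0 → φ.poly.eval x = 0) :
    Nat.card P = Nat.card {x // f.eval x = 0} := by
  symm
  refine Nat.card_congr (Equiv.ofBijective (fun x => ⟨⟨Module.AEval'.of φ.linearMap x.1,
    (mem_torsion_X_iff φ _).2 (hker _ x.2)⟩, (hP _ _).2 x.2⟩) ⟨?_, ?_⟩)
  · intro x y h
    have h1 := congrArg (fun z => (Module.AEval'.of φ.linearMap).symm z.1.1) h
    exact Subtype.ext h1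
  · rintro ⟨⟨y, hy⟩, hy'⟩
    obtain ⟨x, rfl⟩ := (Module.AEval'.of φ.linearMap).surjective y
    exact ⟨⟨x, (hP x hy).1 hy'⟩, rfl⟩

/-- An isogeny whose kernel has `q^s` elements, all of them in `φ[T]`, is of type `(A/TA)^s`. -/
lemma Isogeny.isOfType_X [IsAlgClosed L] (hinj : Function.Injective (algebraMap Fq[X] L))
    {φ : DrinfeldModule Fq L r} (a : φ.Isogeny) {s : ℕ} (hs : s ≤ r)
    (hker : ∀ x, a.f.eval x = 0 → φ.poly.eval x = 0)
    (hcard : Nat.card {x // a.f.eval x = 0} = q ^ s) :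
    a.IsOfType X (standardSubmodule X r s) := by
  obtain ⟨P, hP⟩ := a.exists_submodule_mem_iff
  have hPcard : Nat.card P = q ^ s := (natCard_submodule_torsion_X P hP hker).trans hcard
  have hV := natCard_torsion_X hinj φ
  have hfin : Finite (φ.torsion X) := Nat.finite_of_card_ne_zero (by rw [hV]; positivity)
  have hF : Nat.card (Fin r → Fq[X] ⧸ Ideal.span {(X : Fq[X])}) = q ^ r := by
    rw [Nat.card_fun, Nat.card_fin, natCard_quotient_X, Nat.card_eq_fintype_card]
  have hfin' : Finite (Fin r → Fq[X] ⧸ Ideal.span {(X : Fq[X])}) :=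
    Nat.finite_of_card_ne_zero (by rw [hF]; positivity)
  have hS : Nat.card (standardSubmodule (X : Fq[X]) r s) = q ^ s := by
    rw [natCard_standardSubmodule Fq hs, Nat.card_eq_fintype_card]
  have hX : ∀ m : φ.torsion X, (X : Fq[X]) • m = 0 := Submodule.smul_torsionBy _
  have hex := exists_linearEquiv_mem_iff hX (X_smul_fun_quotient Fq (Fin r)) (hV.trans hF.symm) P
    ((standardSubmodule (X : Fq[X]) r s).restrictScalars Fq) (hPcard.trans hS.symm)
  obtain ⟨b, hb⟩ := hex
  refine ⟨b, fun x => ⟨fun hx => ⟨(mem_torsion_X_iff φ _).2 (hker _ hx), ?_⟩, ?_⟩⟩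
  · exact (hb _).2 ((hP _ _).2 hx)
  · rintro ⟨hx, h⟩
    exact (hP _ _).1 ((hb _).1 h)

lemma Isogeny.IsOfType.eval_poly_eq_zero {φ : DrinfeldModule Fq L r} {a : φ.Isogeny}
    {H : Submodule Fq[X] (Fin r → Fq[X] ⧸ Ideal.span {(X : Fq[X])})} (h : a.IsOfType X H) {x : L}
    (hx : a.f.eval x = 0) : φ.poly.eval x = 0 := by
  obtain ⟨b, hb⟩ := h
  exact (mem_torsion_X_iff φ x).1 ((hb x).1 hx).1

lemma Isogeny.IsOfType.natCard_roots {φ : DrinfeldModule Fq L r} {a : φ.Isogeny} {N : Fq[X]}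
    {H : Submodule Fq[X] (Fin r → Fq[X] ⧸ Ideal.span {N})} (h : a.IsOfType N H) :
    Nat.card {x // a.f.eval x = 0} = Nat.card H := by
  obtain ⟨b, hb⟩ := h
  refine Nat.card_congr (Equiv.ofBijective (fun x => ⟨b ⟨_, ((hb x.1).1 x.2).1⟩,
    ((hb x.1).1 x.2).2⟩) ⟨?_, ?_⟩)
  · rintro ⟨x, hx⟩ ⟨y, hy⟩ h
    simpa using h
  · rintro ⟨y, hy⟩
    obtain ⟨⟨z, hz⟩, rfl⟩ := b.surjective y
    obtain ⟨x, rfl⟩ := (Module.AEval'.of φ.linearMap).surjective z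
    exact ⟨⟨x, (hb x).2 ⟨hz, hy⟩⟩, rfl⟩

end Types

end DrinfeldModule

/-! ### A valuation extending the degree in `T` -/

namespace DrinfeldModule

variable {Fq : Type*} [Field Fq] {r : ℕ}

lemma degT_le_iff {p : CoeffRing Fq r} {n : ℕ} :
    degT p ≤ n ↔ ∀ m, (p.coeff m).natDegree ≤ n := by
  rw [degT, Finset.sup_le_iff]
  refine ⟨fun h m => ?_, fun h m _ => h m⟩
  by_cases hm : m ∈ p.support
  · exact h m hm
  · simp [MvPolynomial.notMem_support_iff.1 hm]

lemma natDegree_coeff_le_degT (p : CoeffRing Fq r) (m) : (p.coeff m).natDegree ≤ degT p :=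
  degT_le_iff.1 le_rfl m

lemma degT_add_le {p p' : CoeffRing Fq r} {n : ℕ} (h : degT p ≤ n) (h' : degT p' ≤ n) :
    degT (p + p') ≤ n := by
  rw [degT_le_iff] at *
  exact fun m => by
    rw [MvPolynomial.coeff_add]
    exact natDegree_add_le_of_degree_le (h m) (h' m)

lemma degT_neg (p : CoeffRing Fq r) : degT (-p) = degT p := by
  simp [degT]

lemma degT_mul_le {p p' : CoeffRing Fq r} {n n' : ℕ} (h : degT p ≤ n) (h' : degT p' ≤ n') :
    degT (p * p') ≤ n + n' := by
  rw [degT_le_iff] at *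
  intro m
  rw [MvPolynomial.coeff_mul]
  refine natDegree_sum_le_of_forall_le _ _ fun x _ => ?_
  exact natDegree_mul_le.trans (add_le_add (h _) (h' _))

lemma degT_one : degT (1 : CoeffRing Fq r) = 0 := by
  refine Nat.le_zero.1 (degT_le_iff.2 fun m => ?_)
  rw [MvPolynomial.coeff_one]
  split_ifs <;> simp

/-- The element `T` of `A[g₁, …, g_(r-1)]`. -/
def varT (Fq : Type*) [Field Fq] (r : ℕ) : CoeffRing Fq r := MvPolynomial.C X

lemma coeff_mul_varT_pow (d : CoeffRing Fq r) (n : ℕ) (m) :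
    (d * varT Fq r ^ n).coeff m = d.coeff m * X ^ n := by
  rw [varT, ← map_pow, mul_comm, MvPolynomial.coeff_C_mul, mul_comm]

lemma degT_mul_varT_pow {d : CoeffRing Fq r} (hd : d ≠ 0) (n : ℕ) :
    degT (d * varT Fq r ^ n) = degT d + n := by
  have key : ∀ m, d.coeff m ≠ 0 →
      ((d * varT Fq r ^ n).coeff m).natDegree = (d.coeff m).natDegree + n := fun m hm => by
    rw [coeff_mul_varT_pow, natDegree_mul_X_pow n hm]
  obtain ⟨m₀, hm₀⟩ := MvPolynomial.ne_zero_iff.1 hd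
  obtain ⟨m, hm, hm'⟩ := Finset.exists_mem_eq_sup d.support
    ⟨m₀, MvPolynomial.mem_support_iff.2 hm₀⟩ fun m => (d.coeff m).natDegree
  refine le_antisymm (degT_le_iff.2 fun m => ?_) ?_
  · by_cases h : d.coeff m = 0
    · simp [coeff_mul_varT_pow, h]
    · rw [key m h]
      exact add_le_add_left (natDegree_coeff_le_degT d m) n
  · rw [degT, hm', ← key m (MvPolynomial.mem_support_iff.1 hm)]
    exact natDegree_coeff_le_degT _ m

lemma varT_ne_zero : varT Fq r ≠ 0 := by
  simp [varT]

/-- An element of `A[g₁, …, g_(r-1)]` is the sum of its leading term in `T` and a remainder. -/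
lemma exists_leading_degT (p : CoeffRing Fq r) (hp : p ≠ 0) :
    ∃ d p' : CoeffRing Fq r, d ≠ 0 ∧ degT d = 0 ∧ p = d * varT Fq r ^ degT p + p' ∧
      (p' = 0 ∨ degT p' < degT p) := by
  set n := degT p with hn
  -- Retain in each coefficient only its T^n-part, which is a constant in F_q.
  let d : CoeffRing Fq r := ∑ m ∈ p.support, MvPolynomial.monomial m (C ((p.coeff m).coeff n))
  have hd : ∀ m, d.coeff m = C ((p.coeff m).coeff n) := by
    intro m
    simp only [d, MvPolynomial.coeff_sum, MvPolynomial.coeff_monomial]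
    rw [Finset.sum_ite_eq' p.support m fun m => C ((p.coeff m).coeff n)]
    split_ifs with h
    · rfl
    · simp [MvPolynomial.notMem_support_iff.1 h]
  obtain ⟨m₀, hm₀⟩ := MvPolynomial.ne_zero_iff.1 hp
  obtain ⟨m, hm, hm'⟩ := Finset.exists_mem_eq_sup p.support
    ⟨m₀, MvPolynomial.mem_support_iff.2 hm₀⟩ fun m => (p.coeff m).natDegree
  refine ⟨d, p - d * varT Fq r ^ n, ?_, ?_, by ring, ?_⟩
  · refine MvPolynomial.ne_zero_iff.2 ⟨m, ?_⟩
    rw [hd, hn, degT, hm', coeff_natDegree, Ne, C_eq_zero, leadingCoeff_eq_zero]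
    exact MvPolynomial.mem_support_iff.1 hm
  · exact Nat.le_zero.1 (degT_le_iff.2 fun m => by rw [hd, natDegree_C])
  · have h1 : ∀ m, (p - d * varT Fq r ^ n).coeff m =
        p.coeff m - C ((p.coeff m).coeff n) * X ^ n := fun m => by
      rw [MvPolynomial.coeff_sub, coeff_mul_varT_pow, hd]
    have h2 : ∀ m, ((p - d * varT Fq r ^ n).coeff m).coeff n = 0 := fun m => by
      rw [h1, coeff_sub, coeff_C_mul_X_pow, if_pos rfl, sub_self]
    have h3 : ∀ m, ((p - d * varT Fq r ^ n).coeff m).natDegree ≤ n := fun m => by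
      rw [h1]
      exact (natDegree_sub_le _ _).trans (max_le (natDegree_coeff_le_degT p m)
        (natDegree_C_mul_X_pow_le _ _))
    -- The zero polynomial also has `degT` equal to 0, so for n = 0 no strict drop is possible and
    -- the remainder must vanish.
    rcases Nat.eq_zero_or_pos n with h0 | h0
    · left
      refine MvPolynomial.ext _ _ fun m => ?_
      have h4 := h2 m
      have h5 := h3 m
      rw [MvPolynomial.coeff_zero]
      generalize (p - d * varT Fq r ^ n).coeff m = c at h4 h5
      rw [h0] at h4 h5
      rw [eq_C_of_natDegree_eq_zero (Nat.le_zero.1 h5), h4, C_0]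
    · right
      refine (Nat.lt_iff_le_pred h0).2 (degT_le_iff.2 fun m => ?_)
      rw [← Nat.lt_iff_le_pred h0]
      refine lt_of_le_of_ne (h3 m) fun h => ?_
      have h4 := h2 m
      generalize (p - d * varT Fq r ^ n).coeff m = c at h h4
      rw [← h, coeff_natDegree, leadingCoeff_eq_zero] at h4
      rw [h4, natDegree_zero] at h
      omega

section Valuation

variable (L : Type*) [Field L] [Algebra (CoeffRing Fq r) L]

/-- The ring of fractions `p / (d T^n)` with `deg_T p ≤ n` and `deg_T d = 0`. -/
def boundedSubring : Subring L where
  carrier := {x | ∃ (n : ℕ) (p d : CoeffRing Fq r), degT p ≤ n ∧ degT d = 0 ∧ d ≠ 0 ∧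
    x * algebraMap _ L (d * varT Fq r ^ n) = algebraMap _ L p}
  mul_mem' := by
    rintro x y ⟨n, p, d, hp, hd, hd0, hx⟩ ⟨n', p', d', hp', hd', hd0', hy⟩
    refine ⟨n + n', p * p', d * d', degT_mul_le hp hp', Nat.le_zero.1 (degT_mul_le hd.le hd'.le),
      mul_ne_zero hd0 hd0', ?_⟩
    rw [map_mul _ p, ← hx, ← hy]
    simp only [map_mul, map_pow]
    ring
  one_mem' := ⟨0, 1, 1, degT_one.le, degT_one, one_ne_zero, by simp⟩
  add_mem' := by
    rintro x y ⟨n, p, d, hp, hd, hd0, hx⟩ ⟨n', p', d', hp', hd', hd0', hy⟩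
    refine ⟨n + n', p * (d' * varT Fq r ^ n') + p' * (d * varT Fq r ^ n), d * d',
      degT_add_le ?_ ?_, Nat.le_zero.1 (degT_mul_le hd.le hd'.le), mul_ne_zero hd0 hd0', ?_⟩
    · refine degT_mul_le hp ?_
      rw [degT_mul_varT_pow hd0', hd', zero_add]
    · rw [add_comm n]
      refine degT_mul_le hp' ?_
      rw [degT_mul_varT_pow hd0, hd, zero_add]
    · rw [map_add, map_mul _ p, map_mul _ p', ← hx, ← hy]
      simp only [map_mul, map_pow]
      ring
  zero_mem' := ⟨0, 0, 1, by simp [degT], degT_one, one_ne_zero, by simp⟩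
  neg_mem' := by
    rintro x ⟨n, p, d, hp, hd, hd0, hx⟩
    exact ⟨n, -p, d, by rwa [degT_neg], hd, hd0, by rw [neg_mul, hx, map_neg]⟩

/-- The degree in `T` extends to a valuation. -/
lemma exists_valuation_degT (hinj : Function.Injective (algebraMap (CoeffRing Fq r) L)) :
    ∃ V : ValuationSubring L, 1 < V.valuation (algebraMap _ L (varT Fq r)) ∧
      ∀ p : CoeffRing Fq r, p ≠ 0 → V.valuation (algebraMap _ L p) =
        V.valuation (algebraMap _ L (varT Fq r)) ^ degT p := by
  set t := algebraMap _ L (varT Fq r) with ht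
  have ht0 : t ≠ 0 := (map_ne_zero_iff _ hinj).2 varT_ne_zero
  let B := boundedSubring (Fq := Fq) (r := r) L
  have htB : t⁻¹ ∈ B := ⟨1, 1, 1, by rw [degT_one]; omega, degT_one, one_ne_zero, by
    rw [one_mul, pow_one, map_one, ← ht, inv_mul_cancel₀ ht0]⟩
  -- A valuation ring over B with 1/T in its maximal ideal exists once 1/T is not a unit of B.
  -- Otherwise T would lie in B, say T = p/(d T^n), whence deg_T p = n + 1 > n.
  have htop : Ideal.span {(⟨t⁻¹, htB⟩ : B)} ≠ ⊤ := by
    rw [Ne, Ideal.span_singleton_eq_top]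
    intro hu
    obtain ⟨⟨b, hb⟩, hb'⟩ := isUnit_iff_exists_inv.1 hu
    have hbt : b = t := by
      have : t⁻¹ * b = 1 := congrArg Subtype.val hb'
      field_simp at this
      exact this
    obtain ⟨n, p, d, hp, hd, hd0, hx⟩ := hb
    rw [hbt, ht, ← map_mul] at hx
    have := hinj hx
    rw [mul_comm, mul_assoc, ← pow_succ] at this
    rw [← this, degT_mul_varT_pow hd0] at hp
    omega
  obtain ⟨V, hBV, hV⟩ := Ideal.image_subset_nonunits_valuationSubring _ htop
  have hle : ∀ x ∈ B, V.valuation x ≤ 1 := fun x hx => (V.valuation_le_one_iff x).2 (hBV hx)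
  have ht1 : 1 < V.valuation t := by
    have h1 := hV ⟨_, Ideal.subset_span rfl, rfl⟩
    rw [SetLike.mem_coe, ValuationSubring.mem_nonunits_iff] at h1
    have h2 : V.valuation t⁻¹ < 1 := h1
    rw [map_inv₀] at h2
    exact (inv_lt_one₀ ((zero_lt_iff).2 ((_root_.map_ne_zero _).2 ht0))).1 h2
  -- A nonzero d of T-degree 0 lies in B together with its inverse. So a leading term d T^n has
  -- value exactly v(T)^n, and it strictly dominates the remainder.
  have hunit : ∀ d : CoeffRing Fq r, d ≠ 0 → degT d = 0 → V.valuation (algebraMap _ L d) = 1 := by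
    intro d hd0 hd
    have hd0' : algebraMap _ L d ≠ 0 := (map_ne_zero_iff _ hinj).2 hd0
    refine le_antisymm (hle _ ⟨0, d, 1, hd.le, degT_one, one_ne_zero, by simp⟩) ?_
    have h1 : V.valuation (algebraMap _ L d)⁻¹ ≤ 1 := hle _ ⟨0, 1, d, degT_one.le, hd, hd0, by
      rw [pow_zero, mul_one, map_one, inv_mul_cancel₀ hd0']⟩
    rw [map_inv₀] at h1
    exact (inv_le_one₀ ((zero_lt_iff).2 ((_root_.map_ne_zero _).2 hd0'))).1 h1
  have hpow : ∀ p : CoeffRing Fq r, V.valuation (algebraMap _ L p) ≤ V.valuation t ^ degT p := by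
    intro p
    have h1 : V.valuation (algebraMap _ L p * (t ^ degT p)⁻¹) ≤ 1 :=
      hle _ ⟨degT p, p, 1, le_rfl, degT_one, one_ne_zero, by
        rw [one_mul, map_pow, ← ht, inv_mul_cancel_right₀ (pow_ne_zero _ ht0)]⟩
    rw [map_mul, map_inv₀, map_pow] at h1
    have h2 : 0 < V.valuation t ^ degT p :=
      zero_lt_iff.2 (pow_ne_zero _ ((_root_.map_ne_zero _).2 ht0))
    rwa [← div_eq_mul_inv, div_le_one₀ h2] at h1
  refine ⟨V, ht1, fun p hp => ?_⟩
  obtain ⟨d, p', hd0, hd, hpd, hp'⟩ := exists_leading_degT p hp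
  have h1 : V.valuation (algebraMap _ L (d * varT Fq r ^ degT p)) = V.valuation t ^ degT p := by
    rw [map_mul, map_mul, hunit d hd0 hd, one_mul, map_pow, map_pow]
  conv_lhs => rw [hpd, map_add]
  rw [Valuation.map_add_eq_of_lt_left, h1]
  rw [h1]
  rcases hp' with rfl | hp'
  · rw [map_zero, map_zero]
    exact zero_lt_iff.2 (pow_ne_zero _ ((_root_.map_ne_zero _).2 ht0))
  · exact (hpow p').trans_lt (pow_lt_pow_right₀ ht1 hp')

end Valuation

end DrinfeldModule

/-! ### Rationality, integrality and degree bounds for `∏ (X - b)` -/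

/-- The polynomial `∏ (X - G(z))` over the roots `z` of `N` is rational. -/
lemma Polynomial.exists_map_eq_prod_X_sub_C_eval {K L : Type*} [Field K] [Field L] [Algebra K L]
    {N : K[X]} (hN : N ≠ 0) (hs : (N.map (algebraMap K L)).Splits) (G : K[X]) :
    ∃ P : K[X], P.map (algebraMap K L) = ((N.map (algebraMap K L)).roots.map
      fun z => X - C ((G.map (algebraMap K L)).eval z)).prod := by
  set φ := algebraMap K L
  set N' := N.map φ with hN'
  have hN0 : N' ≠ 0 := (Polynomial.map_ne_zero_iff φ.injective).2 hN
  -- The outer variable Y is the one eliminated: the resultant of N(Y) and X - G(Y) is defined over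
  -- K, and over L it is a power of the leading coefficient of N times the product sought.
  let g : K[X][X] := C X - G.map C
  let g' : L[X][X] := C X - (G.map φ).map C
  have hg' : g.map (mapRingHom φ) = g' := by
    simp only [g, g', Polynomial.map_sub, map_C, coe_mapRingHom, map_X, Polynomial.map_map]
    congr 2
    ext x : 1
    simp
  have hNmap : (N.map C).map (mapRingHom φ) = N'.map C := by
    rw [hN', Polynomial.map_map, Polynomial.map_map]
    congr 1
    ext x : 1
    simp
  have hdeg : N.natDegree = (N'.map (C : L →+* L[X])).natDegree := by
    rw [natDegree_map_eq_of_injective C_injective, natDegree_map]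
  have hroots : (N'.map (C : L →+* L[X])).roots = N'.roots.map C := by
    refine (roots_map_of_injective_of_card_eq_natDegree C_injective ?_).symm
    exact hs.natDegree_eq_card_roots.symm
  have hres := resultant_eq_prod_eval (N'.map (C : L →+* L[X])) g' g.natDegree
    (by rw [← hg']; exact natDegree_map_le) (hs.map C)
  rw [← hdeg, hroots, ← hNmap, ← hg', resultant_map_map, hNmap, hg', Multiset.map_map,
    leadingCoeff_map_of_injective C_injective] at hres
  have hlc : N.leadingCoeff ≠ 0 := leadingCoeff_ne_zero.2 hN
  refine ⟨C ((N.leadingCoeff ^ g.natDegree)⁻¹) *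
    resultant (N.map C) g N.natDegree g.natDegree, ?_⟩
  rw [coe_mapRingHom] at hres
  rw [Polynomial.map_mul, hres, map_C, ← C_pow, hN', leadingCoeff_map, ← map_pow, ← mul_assoc,
    ← C_mul, ← map_mul, inv_mul_cancel₀ (pow_ne_zero _ hlc), map_one, C_1, one_mul]
  congr 1
  refine Multiset.map_congr rfl fun z _ => ?_
  simp only [g', Function.comp_apply, eval_sub, eval_C, eval_map]
  rw [eval₂_at_apply, ← eval_map]

/-- A rational polynomial all of whose roots are integral has integral coefficients. -/
lemma Polynomial.exists_map_eq_of_isIntegral {R K L ι : Type*} [CommRing R] [IsDomain R]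
    [IsIntegrallyClosed R] [Field K] [Algebra R K] [IsFractionRing R K] [Field L] [Algebra K L]
    [Algebra R L] [IsScalarTower R K L] {P : K[X]} {Z : Finset ι} {b : ι → L}
    (hP : P.map (algebraMap K L) = ∏ z ∈ Z, (X - C (b z))) (hb : ∀ z ∈ Z, IsIntegral R (b z)) :
    ∃ Q : R[X], Q.map (algebraMap R L) = ∏ z ∈ Z, (X - C (b z)) := by
  have h1 : P ∈ lifts (algebraMap R K) := by
    rw [lifts_iff_coeff_lifts]
    intro n
    refine IsIntegrallyClosed.isIntegral_iff.1 ?_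
    have h2 : IsIntegral R (algebraMap K L (P.coeff n)) := by
      rw [← coeff_map, hP]
      have h3 : ∏ z ∈ Z, (X - C (b z)) ∈ lifts (algebraMap (integralClosure R L) L) := by
        refine prod_mem fun z hz => (lifts_iff_coeff_lifts _).2 fun i => ?_
        refine ⟨⟨(X - C (b z)).coeff i, ?_⟩, rfl⟩
        rw [mem_integralClosure_iff, coeff_sub, coeff_X, coeff_C]
        refine IsIntegral.sub ?_ ?_
        · split_ifs
          exacts [isIntegral_one, isIntegral_zero]
        · split_ifs
          exacts [hb z hz, isIntegral_zero]
      obtain ⟨c, hc⟩ := (lifts_iff_coeff_lifts _).1 h3 n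
      rw [← hc]
      exact c.2
    exact (isIntegral_algebraMap_iff (algebraMap K L).injective).1 h2
  obtain ⟨Q, hQ⟩ := (mem_lifts _).1 h1
  exact ⟨Q, by rw [IsScalarTower.algebraMap_eq R K L, ← Polynomial.map_map, hQ, hP]⟩

/-- The valuative criterion for integrality. -/
lemma isIntegral_of_forall_valuation_le_one {R L : Type*} [CommRing R] [Field L] [Algebra R L]
    {x : L} (h : ∀ V : ValuationSubring L, (∀ p : R, V.valuation (algebraMap R L p) ≤ 1) →
      V.valuation x ≤ 1) : IsIntegral R x := by
  by_contra hx
  have hx' : x ∉ (integralClosure R L).toSubring := hx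
  obtain ⟨V, hV, hxV⟩ := Subring.exists_le_valuationSubring_of_isIntegrallyClosedIn hx'
  refine hxV ((V.valuation_le_one_iff x).1 (h V fun p => (V.valuation_le_one_iff _).2 ?_))
  exact hV (algebraMap_mem (integralClosure R L) p)

/-- Up to sign the coefficient is an elementary symmetric function of degree `Z.card - k` in the
roots, so the bound is the ultrametric inequality. Adding one factor at a time avoids the explicit
symmetric functions. -/
lemma Valuation.coeff_prod_X_sub_C_le {L Γ ι : Type*} [Field L]
    [LinearOrderedCommGroupWithZero Γ] (v : Valuation L Γ) {B : Γ} (Z : Finset ι) (b : ι → L)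
    (hb : ∀ z ∈ Z, v (b z) ≤ B) (k : ℕ) (hk : k ≤ Z.card) :
    v ((∏ z ∈ Z, (X - C (b z))).coeff k) ≤ B ^ (Z.card - k) := by
  classical
  induction Z using Finset.induction_on generalizing k with
  | empty =>
    have : k = 0 := by simpa using hk
    simp [this]
  | insert z Z hz ih =>
    have ih' := ih fun y hy => hb y (Finset.mem_insert_of_mem hy)
    have hbz := hb z (Finset.mem_insert_self z Z)
    rw [Finset.prod_insert hz, Finset.card_insert_of_notMem hz] at *
    set Q := ∏ z ∈ Z, (X - C (b z)) with hQ
    have hQdeg : Q.natDegree = Z.card := natDegree_finsetProd_X_sub_C_eq_card _ _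
    have hmul : ∀ i ≤ Z.card, v (b z * Q.coeff i) ≤ B ^ (Z.card + 1 - i) := fun i hi => by
      rw [map_mul, show Z.card + 1 - i = (Z.card - i) + 1 by omega, pow_succ']
      exact mul_le_mul' hbz (ih' i hi)
    rw [sub_mul, coeff_sub, coeff_C_mul]
    cases k with
    | zero =>
      rw [coeff_X_mul_zero, zero_sub, Valuation.map_neg]
      exact hmul 0 (Nat.zero_le _)
    | succ k =>
      rw [coeff_X_mul]
      refine (v.map_sub _ _).trans (max_le ?_ ?_)
      · have := ih' k (by omega)
        rwa [show Z.card + 1 - (k + 1) = Z.card - k by omega]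
      · by_cases h : k + 1 ≤ Z.card
        · exact hmul _ h
        · rw [coeff_eq_zero_of_natDegree_lt (by rw [hQdeg]; omega), mul_zero, map_zero]
          exact zero_le

namespace DrinfeldModule

variable {Fq : Type*} [Field Fq] {r : ℕ}

lemma algebraMap_genericField_injective :
    Function.Injective (algebraMap (CoeffRing Fq r) (GenericField Fq r)) := by
  rw [IsScalarTower.algebraMap_eq (CoeffRing Fq r) (FractionRing (CoeffRing Fq r))]
  exact (algebraMap (FractionRing (CoeffRing Fq r)) (GenericField Fq r)).injective.comp
    (IsFractionRing.injective _ _)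

/-- A product `∏ (X - j(z))` over the roots `z` of a separable polynomial `N`, whose factors
`j(z) = G(z)` are integral and have the same degree `w` in `T`, has integral coefficients of
controlled degree in `T`. -/
theorem exists_coeffRing_polynomial {N G : (CoeffRing Fq r)[X]}
    (hN : (N.map (algebraMap _ (GenericField Fq r))).Separable) {Z : Finset (GenericField Fq r)}
    (hZ : ∀ z, z ∈ Z ↔ (N.map (algebraMap _ (GenericField Fq r))).eval z = 0)
    {j : GenericField Fq r → GenericField Fq r}
    (hj : ∀ z ∈ Z, j z = (G.map (algebraMap _ (GenericField Fq r))).eval z)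
    (hint : ∀ z ∈ Z, IsIntegral (CoeffRing Fq r) (j z)) {w : ℕ}
    (hw : ∀ V : ValuationSubring (GenericField Fq r),
      1 < V.valuation (algebraMap _ _ (varT Fq r)) →
      (∀ p : CoeffRing Fq r, p ≠ 0 → V.valuation (algebraMap _ _ p) =
        V.valuation (algebraMap _ _ (varT Fq r)) ^ degT p) →
      ∀ z ∈ Z, V.valuation (j z) = V.valuation (algebraMap _ _ (varT Fq r)) ^ w) :
    ∃ P : (CoeffRing Fq r)[X], P.map (algebraMap _ (GenericField Fq r)) =
        ∏ z ∈ Z, (X - C (j z)) ∧ P.natDegree = Z.card ∧ P.coeff 0 ≠ 0 ∧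
      degT (P.coeff 0) = Z.card * w ∧ (∀ k ≤ Z.card, degT (P.coeff k) ≤ (Z.card - k) * w) ∧
      height P = Z.card * w := by
  classical
  have hinj := algebraMap_genericField_injective (Fq := Fq) (r := r)
  have hmap : ∀ Q : (CoeffRing Fq r)[X], (Q.map (algebraMap _ (FractionRing (CoeffRing Fq r)))).map
      (algebraMap (FractionRing (CoeffRing Fq r)) (GenericField Fq r)) =
      Q.map (algebraMap _ (GenericField Fq r)) := fun Q => by
    rw [Polynomial.map_map, ← IsScalarTower.algebraMap_eq]
  have hN0 : N.map (algebraMap _ (FractionRing (CoeffRing Fq r))) ≠ 0 := by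
    intro h
    rw [← hmap, h, Polynomial.map_zero] at hN
    exact hN.ne_zero rfl
  obtain ⟨P₀, hP₀⟩ := exists_map_eq_prod_X_sub_C_eval (L := GenericField Fq r) hN0
    (IsAlgClosed.splits _)
    (G.map (algebraMap _ (FractionRing (CoeffRing Fq r))))
  rw [hmap, hmap] at hP₀
  have hroots : Z.val = (N.map (algebraMap _ (GenericField Fq r))).roots := by
    rw [← (Multiset.toFinset_val _).trans (nodup_roots hN).dedup]
    congr 1
    ext z
    rw [hZ, Multiset.mem_toFinset, mem_roots hN.ne_zero, IsRoot]
  have hP₁ : P₀.map (algebraMap (FractionRing (CoeffRing Fq r)) (GenericField Fq r)) =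
      ∏ z ∈ Z, (X - C (j z)) := by
    rw [hP₀, ← hroots, Finset.prod_congr rfl fun z hz => by rw [hj z hz]]
    rfl
  obtain ⟨P, hP⟩ := exists_map_eq_of_isIntegral (R := CoeffRing Fq r) hP₁ hint
  obtain ⟨V, hV1, hV⟩ := exists_valuation_degT (GenericField Fq r) hinj
  set v := V.valuation
  set t := v (algebraMap _ (GenericField Fq r) (varT Fq r))
  have hvj := hw V hV1 hV
  have hcoeff : ∀ k ≤ Z.card, degT (P.coeff k) ≤ (Z.card - k) * w := by
    intro k hk
    by_cases h0 : P.coeff k = 0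
    · simp [h0, degT]
    · have h1 := v.coeff_prod_X_sub_C_le Z j (fun z hz => (hvj z hz).le) k hk
      rw [← hP, coeff_map, hV _ h0, ← pow_mul] at h1
      rw [mul_comm]
      exact (pow_le_pow_iff_right₀ hV1).1 h1
  -- Up to sign the constant term is the product of the roots, so equal values of all roots give an
  -- equality here rather than a bound.
  have hv0 : v (algebraMap _ (GenericField Fq r) (P.coeff 0)) = t ^ (Z.card * w) := by
    rw [← coeff_map, hP, coeff_zero_prod, map_prod, mul_comm, pow_mul, ← Finset.prod_const]
    refine Finset.prod_congr rfl fun z hz => ?_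
    rw [← hvj z hz]
    simp [v]
  have ht0 : t ≠ 0 := (zero_lt_one.trans hV1).ne'
  have hP0 : P.coeff 0 ≠ 0 := by
    intro h
    rw [h, map_zero, map_zero] at hv0
    exact pow_ne_zero _ ht0 hv0.symm
  have hdeg0 : degT (P.coeff 0) = Z.card * w := by
    rw [hV _ hP0] at hv0
    exact pow_right_injective₀ (zero_lt_one.trans hV1) hV1.ne' hv0
  have hnat : P.natDegree = Z.card := by
    rw [← natDegree_map_eq_of_injective hinj, hP, natDegree_finsetProd_X_sub_C_eq_card]
  refine ⟨P, hP, hnat, hP0, hdeg0, hcoeff, le_antisymm (Finset.sup_le fun k hk => ?_) ?_⟩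
  · have hk' : k ≤ Z.card := hnat ▸ le_natDegree_of_mem_supp k hk
    exact (hcoeff k hk').trans (Nat.mul_le_mul_right _ (Nat.sub_le _ _))
  · rw [← hdeg0]
    exact Finset.le_sup (f := fun k => degT (P.coeff k)) (mem_support_iff.2 hP0)

end DrinfeldModule

/-! ### Weights and valuations of the coefficients of the targets -/

namespace DrinfeldModule

section Weights

variable {q r : ℕ} {e : ℕ → ℕ}

lemma weight_relation_int (hq : 1 < q)
    (he : ∑ i ∈ Finset.Ico 1 r, e i * (q ^ i - 1) = e r * (q ^ r - 1)) :
    ∑ i ∈ Finset.Ico 1 r, (e i : ℤ) * ((q : ℤ) ^ i - 1) = e r * ((q : ℤ) ^ r - 1) := by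
  have h1 : ∀ i, ((q ^ i - 1 : ℕ) : ℤ) = (q : ℤ) ^ i - 1 := fun i => by
    rw [Nat.cast_sub (Nat.one_le_pow _ _ (by omega))]
    simp
  have h2 := congrArg (fun n : ℕ => (n : ℤ)) he
  push_cast [h1] at h2
  exact h2

/-- Replacing each q^i - 1 by the larger q^r - 1 in the weight relation gives e_r ≤ e_1 + ... +
e_(r-1). -/
lemma weightOne_nonneg (hq : 1 < q) (hr : 0 < r)
    (he : ∑ i ∈ Finset.Ico 1 r, e i * (q ^ i - 1) = e r * (q ^ r - 1)) :
    0 ≤ weightOne q r e := by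
  have h := weight_relation_int hq he
  rw [weightOne]
  refine mul_nonneg (by positivity) ?_
  have hqr : (0 : ℤ) < (q : ℤ) ^ r - 1 := by
    have : (1 : ℤ) < (q : ℤ) ^ r := one_lt_pow₀ (by exact_mod_cast hq) (by omega)
    linarith
  refine le_of_mul_le_mul_right (a := (q : ℤ) ^ r - 1) ?_ hqr
  rw [zero_mul, sub_mul, ← h, Finset.sum_mul, ← Finset.sum_sub_distrib]
  refine Finset.sum_nonneg fun i hi => ?_
  rw [← mul_sub]
  refine mul_nonneg (by positivity) ?_
  have : (q : ℤ) ^ i ≤ (q : ℤ) ^ r := pow_le_pow_right₀ (by exact_mod_cast hq.le)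
    (Finset.mem_Ico.1 hi).2.le
  linarith

lemma weightCorank_nonneg (hq : 1 < q) (hr : 0 < r) : 0 ≤ weightCorank q r e := by
  rw [weightCorank]
  refine add_nonneg (Finset.sum_nonneg fun i _ => by positivity) (mul_nonneg (by positivity) ?_)
  obtain ⟨m, rfl⟩ : ∃ m, r = m + 1 := ⟨r - 1, by omega⟩
  have h1 : (1 : ℤ) ≤ (q : ℤ) ^ m := one_le_pow₀ (by exact_mod_cast hq.le)
  have h2 : (2 : ℤ) ≤ q := by exact_mod_cast hq
  rw [Nat.add_sub_cancel, pow_succ]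
  nlinarith

/-- The left side is the exponent of v(z) in v(J), and psi_r is the exponent of v(z) in v(T).
Multiplying by q - 1 turns the geometric sums into q^r - q^i, and the weight relation eliminates the
sum of the e_i q^i. -/
lemma sum_mul_weightOne (hq : 1 < q)
    (he : ∑ i ∈ Finset.Ico 1 r, e i * (q ^ i - 1) = e r * (q ^ r - 1)) {w : ℕ}
    (hw : (w : ℤ) = weightOne q r e) :
    ∑ i ∈ Finset.Ico 1 r, q * (∑ l ∈ Finset.Ico i r, q ^ l) * e i =
      (∑ l ∈ Finset.range r, q ^ l) * w := by
  have h := weight_relation_int hq he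
  have hq' : ((q : ℤ) - 1) ≠ 0 := by
    have : (1 : ℤ) < q := by exact_mod_cast hq
    omega
  have key : ∀ i ∈ Finset.Ico 1 r,
      ((q * (∑ l ∈ Finset.Ico i r, q ^ l) * e i : ℕ) : ℤ) * ((q : ℤ) - 1) =
        (q : ℤ) * (e i * ((q : ℤ) ^ r - 1)) - q * (e i * ((q : ℤ) ^ i - 1)) := fun i hi => by
    have h1 := geom_sum_Ico_mul (q : ℤ) (Finset.mem_Ico.1 hi).2.le
    push_cast
    linear_combination (q : ℤ) * e i * h1
  have h2 := geom_sum_mul (q : ℤ) r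
  have h3 : ((∑ i ∈ Finset.Ico 1 r, q * (∑ l ∈ Finset.Ico i r, q ^ l) * e i : ℕ) : ℤ) =
      (((∑ l ∈ Finset.range r, q ^ l) * w : ℕ) : ℤ) := by
    refine mul_right_cancel₀ hq' ?_
    rw [Nat.cast_sum, Finset.sum_mul, Finset.sum_congr rfl key, Finset.sum_sub_distrib,
      ← Finset.mul_sum, ← Finset.mul_sum, h, ← Finset.sum_mul, Nat.cast_mul, hw, weightOne]
    push_cast
    linear_combination (-(q : ℤ) * (∑ i ∈ Finset.Ico 1 r, (e i : ℤ) - e r)) * h2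
  exact_mod_cast h3

/-- The left side is the exponent of v(c) in v(J)^(q^(r-1)), while v(T)^(q^(r-1)) = v(c)^(psi_r). As
in rank one, the identity follows from the weight relation after multiplication by q - 1. -/
lemma sum_mul_weightCorank (hq : 1 < q) (hr : 0 < r)
    (he : ∑ i ∈ Finset.Ico 1 r, e i * (q ^ i - 1) = e r * (q ^ r - 1)) {w : ℕ}
    (hw : (w : ℤ) = weightCorank q r e) :
    ∑ i ∈ Finset.Ico 1 r, ((∑ l ∈ Finset.range (r - 1 - i), q ^ l) * q ^ i +
        q ^ i * q ^ (r - 1)) * e i = (∑ l ∈ Finset.range r, q ^ l) * w := by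
  have h := weight_relation_int hq he
  obtain ⟨m, rfl⟩ : ∃ m, r = m + 1 := ⟨r - 1, by omega⟩
  rw [Nat.add_sub_cancel] at *
  have hq' : ((q : ℤ) - 1) ≠ 0 := by
    have : (1 : ℤ) < q := by exact_mod_cast hq
    omega
  have key : ∀ i ∈ Finset.Ico 1 (m + 1),
      ((((∑ l ∈ Finset.range (m - i), q ^ l) * q ^ i + q ^ i * q ^ m) * e i : ℕ) : ℤ) *
          ((q : ℤ) - 1) =
        ((q : ℤ) ^ (m + 1) - q ^ m - 1) * (e i * ((q : ℤ) ^ i - 1)) +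
          ((q : ℤ) ^ (m + 1) - 1) * e i := fun i hi => by
    have h1 := geom_sum_mul (q : ℤ) (m - i)
    have h2 : (q : ℤ) ^ (m - i) * q ^ i = q ^ m := by
      rw [← pow_add, Nat.sub_add_cancel]
      have := (Finset.mem_Ico.1 hi).2
      omega
    push_cast
    linear_combination (q : ℤ) ^ i * e i * h1 + (e i : ℤ) * h2
  have h2 := geom_sum_mul (q : ℤ) (m + 1)
  have h3 : ((∑ i ∈ Finset.Ico 1 (m + 1), ((∑ l ∈ Finset.range (m - i), q ^ l) * q ^ i +
      q ^ i * q ^ m) * e i : ℕ) : ℤ) = (((∑ l ∈ Finset.range (m + 1), q ^ l) * w : ℕ) : ℤ) := by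
    refine mul_right_cancel₀ hq' ?_
    rw [Nat.cast_sum, Finset.sum_mul, Finset.sum_congr rfl key, Finset.sum_add_distrib,
      ← Finset.mul_sum, ← Finset.mul_sum, h, Nat.cast_mul, hw, weightCorank]
    rw [Nat.add_sub_cancel]
    push_cast
    linear_combination (-(∑ i ∈ Finset.Ico 1 (m + 1), (e i : ℤ)) -
      e (m + 1) * ((q : ℤ) ^ (m + 1) - q ^ m - 1)) * h2
  exact_mod_cast h3

end Weights

section Valuations

variable {L Γ : Type*} [Field L] [LinearOrderedCommGroupWithZero Γ] (v : Valuation L Γ)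
  {q r : ℕ} {g : ℕ → L}

/-! ### Kernels of rank one: values along the recursion for k_i -/

section Rank

variable {k : ℕ → L} {z : L} (hk : ∀ i, k i = g i + k (i + 1) * z ^ q ^ i) (hkr : k (r + 1) = 0)
  (hg : ∀ i, 1 ≤ i → v (g i) ≤ 1)

include hk hkr hg

lemma valuation_descending_le_one (hz : v z ≤ 1) (i : ℕ) (hi : 1 ≤ i) (hir : i ≤ r + 1) :
    v (k i) ≤ 1 := by
  obtain ⟨j, hj⟩ : ∃ j, i + j = r + 1 := ⟨r + 1 - i, by omega⟩
  induction j generalizing i with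
  | zero =>
    rw [show i = r + 1 by omega, hkr, map_zero]
    exact zero_le_one
  | succ j ih =>
    rw [hk i]
    refine (v.map_add _ _).trans (max_le (hg i hi) ?_)
    rw [map_mul, map_pow]
    exact mul_le_one' (ih (i + 1) (by omega) (by omega) (by omega)) (pow_le_one' hz _)

/-- Starting from k_r = 1 and going down, the term k_(i+1) z^(q^i) has value > 1 ≥ v(g_i), so it
dominates and each step adds q^i to the exponent. -/
lemma valuation_descending_eq (hgr : g r = 1) (hq : 0 < q) (hz : 1 < v z) (i : ℕ) (hi : 1 ≤ i)
    (hir : i ≤ r) : v (k i) = v z ^ ∑ l ∈ Finset.Ico i r, q ^ l := by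
  obtain ⟨j, hj⟩ : ∃ j, i + j = r := ⟨r - i, by omega⟩
  induction j generalizing i with
  | zero =>
    obtain rfl : i = r := by omega
    rw [hk i, hkr, hgr]
    simp
  | succ j ih =>
    have h1 : v (k (i + 1) * z ^ q ^ i) = v z ^ ∑ l ∈ Finset.Ico i r, q ^ l := by
      rw [map_mul, map_pow, ih (i + 1) (by omega) (by omega) (by omega), ← pow_add,
        Finset.sum_eq_sum_Ico_succ_bot (show i < r by omega), add_comm]
    rw [hk i, Valuation.map_add_eq_of_lt_right, h1]
    rw [h1]
    refine (hg i hi).trans_lt (one_lt_pow₀ hz ?_)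
    rw [Finset.sum_eq_sum_Ico_succ_bot (show i < r by omega)]
    have := Nat.pow_pos (n := i) hq
    omega

/-- The term k_i^q dominates z k_(i+1): with S the exponent of k_(i+1), one compares q(q^i + S) with
1 + S, and q^i > 1 because i ≥ 1. -/
lemma valuation_target_descending (hgr : g r = 1) (hq : 1 < q) (hz : 1 < v z) (i : ℕ) (hi : 1 ≤ i)
    (hir : i < r) :
    v (k i ^ q - z * k (i + 1)) = v z ^ (q * ∑ l ∈ Finset.Ico i r, q ^ l) := by
  have h1 : v (k i ^ q) = v z ^ (q * ∑ l ∈ Finset.Ico i r, q ^ l) := by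
    rw [map_pow, valuation_descending_eq v hk hkr hg hgr (by omega) hz i hi hir.le, ← pow_mul,
      mul_comm]
  rw [Valuation.map_sub_eq_of_lt_left, h1]
  rw [h1, map_mul, valuation_descending_eq v hk hkr hg hgr (by omega) hz (i + 1) (by omega)
    (by omega), ← pow_succ']
  refine pow_lt_pow_right₀ hz ?_
  rw [Finset.sum_eq_sum_Ico_succ_bot hir]
  have h2 : 1 < q ^ i := Nat.one_lt_pow (by omega) hq
  refine lt_of_lt_of_le ?_ (Nat.le_mul_of_pos_left _ (by omega : 0 < q))
  omega

end Rank

/-! ### Kernels of corank one: values along the recursion for E_i -/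

section Corank

variable {E : ℕ → L} {c : L} (hE : ∀ i, E i ^ q = g i + c * E (i + 1)) (hEr : E r = 1)
  (hg : ∀ i, 1 ≤ i → v (g i) ≤ 1)

include hE hEr hg

lemma valuation_ascending_le_one (hq : q ≠ 0) (hc : v c ≤ 1) (i : ℕ) (hi : 1 ≤ i) (hir : i ≤ r) :
    v (E i) ≤ 1 := by
  obtain ⟨j, hj⟩ : ∃ j, i + j = r := ⟨r - i, by omega⟩
  induction j generalizing i with
  | zero =>
    rw [show i = r by omega, hEr, map_one]
  | succ j ih =>
    refine (pow_le_one_iff_of_nonneg zero_le hq).1 ?_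
    rw [← map_pow, hE i]
    refine (v.map_add _ _).trans (max_le (hg i hi) ?_)
    rw [map_mul]
    exact mul_le_one' hc (ih (i + 1) (by omega) (by omega) (by omega))

/-- Since v(c E_(i+1)) > 1 ≥ v(g_i), the recursion reduces to v(E_i)^q = v(c) v(E_(i+1)). Solving it
downwards from E_r = 1 would require q-th roots of v(c), so the formula is stated after raising to
the power q^j. -/
lemma valuation_ascending_pow_eq (hq : 0 < q) (hc : 1 < v c) (i : ℕ) (hi : 1 ≤ i) (j : ℕ)
    (hj : i + j = r) :
    v (E i) ^ q ^ j = v c ^ ∑ l ∈ Finset.range j, q ^ l ∧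
      (i < r → v (E i) ^ q = v c * v (E (i + 1))) := by
  induction j generalizing i with
  | zero =>
    obtain rfl : i = r := by omega
    simp [hEr]
  | succ j ih =>
    have h1 := (ih (i + 1) (by omega) (by omega)).1
    have h2 : 1 ≤ v (E (i + 1)) := by
      refine (one_le_pow_iff_of_nonneg zero_le (pow_ne_zero j hq.ne')).1 ?_
      rw [h1]
      exact one_le_pow₀ hc.le
    have h3 : v (E i) ^ q = v c * v (E (i + 1)) := by
      rw [← map_pow, hE i, Valuation.map_add_eq_of_lt_right, map_mul]
      rw [map_mul]
      exact (hg i hi).trans_lt (one_lt_mul_of_lt_of_le' hc h2)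
    refine ⟨?_, fun _ => h3⟩
    rw [pow_succ' q, pow_mul, h3, mul_pow, h1, ← pow_add, Finset.sum_range_succ, add_comm]

lemma one_le_valuation_ascending (hq : 0 < q) (hc : 1 < v c) (i : ℕ) (hi : 1 ≤ i) (hir : i ≤ r) :
    1 ≤ v (E i) := by
  refine (one_le_pow_iff_of_nonneg zero_le (pow_ne_zero (r - i) hq.ne')).1 ?_
  rw [(valuation_ascending_pow_eq v hE hEr hg hq hc i hi (r - i) (by omega)).1]
  exact one_le_pow₀ hc.le

/-- The second term dominates, because v(E_i) ≤ v(E_i)^q = v(c) v(E_(i+1)) < v(c)^(q^i) v(E_(i+1));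
the first inequality uses v(E_i) ≥ 1, the last one i ≥ 1. -/
lemma valuation_target_ascending_pow (hq : 1 < q) (hc : 1 < v c) (i : ℕ) (hi : 1 ≤ i)
    (hir : i < r) :
    v (E i - E (i + 1) * c ^ q ^ i) ^ q ^ (r - 1) =
      v c ^ ((∑ l ∈ Finset.range (r - 1 - i), q ^ l) * q ^ i + q ^ i * q ^ (r - 1)) := by
  have h1 := one_le_valuation_ascending v hE hEr hg (by omega) hc i hi hir.le
  have h2 := one_le_valuation_ascending v hE hEr hg (by omega) hc (i + 1) (by omega) hir
  have h3 := (valuation_ascending_pow_eq v hE hEr hg (by omega) hc i hi (r - i) (by omega)).2 hir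
  have h4 := (valuation_ascending_pow_eq v hE hEr hg (by omega) hc (i + 1) (by omega)
    (r - 1 - i) (by omega)).1
  have h5 : v (E i) < v (E (i + 1) * c ^ q ^ i) := by
    rw [map_mul, map_pow, mul_comm]
    refine (le_self_pow₀ h1 (by omega : q ≠ 0)).trans_lt (h3.trans_lt ?_)
    refine mul_lt_mul_of_pos_right ?_ (zero_lt_one.trans_le h2)
    exact lt_self_pow₀ hc (Nat.one_lt_pow (by omega) hq)
  have h6 : q ^ (r - 1 - i) * q ^ i = q ^ (r - 1) := by
    rw [← pow_add, Nat.sub_add_cancel (by omega)]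
  rw [Valuation.map_sub_eq_of_lt_right _ h5, map_mul, map_pow, mul_pow, ← pow_mul, pow_add,
    pow_mul _ _ (q ^ i), ← h4, ← pow_mul, h6]

end Corank

end Valuations

end DrinfeldModule

/-! ### The two recursions -/

namespace DrinfeldModule

section Recursions

variable {S S' : Type*} [CommRing S] [CommRing S']

/-- The coefficients of the quotient of `∑ g_i X^(q^i)` by `X^q - z X` on the right, from the top:
the `j`-th term is the coefficient with index `r + 1 - j`. -/
def descendingAux (q r : ℕ) (g : ℕ → S) (z : S) : ℕ → S
  | 0 => 0
  | j + 1 => g (r - j) + descendingAux q r g z j * z ^ q ^ (r - j)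

/-- The sequence with `k_i = g_i + k_(i+1) z^(q^i)` and `k_i = 0` for `i > r`. -/
def descending (q r : ℕ) (g : ℕ → S) (z : S) (i : ℕ) : S := descendingAux q r g z (r + 1 - i)

/-- The sequence with `E_0 = 0` and `E_(i+1) = y (E_i^q - g_i)`. -/
def ascending (q : ℕ) (g : ℕ → S) (y : S) : ℕ → S
  | 0 => 0
  | i + 1 => y * (ascending q g y i ^ q - g i)

variable {q r : ℕ} {g : ℕ → S} {z y : S}

lemma descending_of_gt {i : ℕ} (hi : r < i) : descending q r g z i = 0 := by
  rw [descending, Nat.sub_eq_zero_of_le (by omega), descendingAux]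

lemma descending_eq (hg : ∀ i, r < i → g i = 0) (i : ℕ) :
    descending q r g z i = g i + descending q r g z (i + 1) * z ^ q ^ i := by
  rcases le_or_gt i r with hi | hi
  · rw [descending, descending, show r + 1 - i = (r - i) + 1 by omega, descendingAux,
      show r - (r - i) = i by omega, show r + 1 - (i + 1) = r - i by omega]
  · rw [descending_of_gt hi, descending_of_gt (by omega), hg i hi]
    simp

lemma map_descending (f : S →+* S') (i : ℕ) :
    f (descending q r g z i) = descending q r (fun i => f (g i)) (f z) i := by
  rw [descending, descending]
  generalize r + 1 - i = j
  induction j with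
  | zero => simp [descendingAux]
  | succ j ih => rw [descendingAux, descendingAux, map_add, map_mul, map_pow, ih]

lemma map_ascending (f : S →+* S') (i : ℕ) :
    f (ascending q g y i) = ascending q (fun i => f (g i)) (f y) i := by
  induction i with
  | zero => simp [ascending]
  | succ i ih => rw [ascending, ascending, map_mul, map_sub, map_pow, ih]

/-- Once E_r = 1 = g_r, the recursion gives E_(r+1) = 0 and stays there, so the sequence terminates.
-/
lemma ascending_of_gt (hq : q ≠ 0) (hgr : g r = 1) (hg : ∀ i, r < i → g i = 0)
    (h : ascending q g y r = 1) (i : ℕ) (hi : r < i) : ascending q g y i = 0 := by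
  induction i, hi using Nat.le_induction with
  | base => rw [ascending, h, hgr, one_pow, sub_self, mul_zero]
  | succ i hi ih => rw [ascending, ih, hg i hi, zero_pow hq, sub_self, mul_zero]

/-- Running the recursion over S[X] at the point X produces its terms as polynomials in z; this
lemma and the next ones say that base change and specialization return the recursion itself. -/
lemma map_C_descending (f : S →+* S') (i : ℕ) :
    (descending q r (fun i => C (g i)) (X : S[X]) i).map f =
      descending q r (fun i => C (f (g i))) X i := by
  have h := DrinfeldModule.map_descending (S := S[X]) (S' := S'[X]) (q := q) (r := r)
    (g := fun i => C (g i)) (z := X) (mapRingHom f) i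
  simpa using h

lemma eval_descending (x : S) (i : ℕ) :
    (descending q r (fun i => C (g i)) (X : S[X]) i).eval x = descending q r g x i := by
  have h := DrinfeldModule.map_descending (S := S[X]) (S' := S) (q := q) (r := r)
    (g := fun i => C (g i)) (z := X) (evalRingHom x) i
  simpa using h

lemma map_C_ascending (f : S →+* S') (i : ℕ) :
    (ascending q (fun i => C (g i)) (X : S[X]) i).map f =
      ascending q (fun i => C (f (g i))) X i := by
  have h := DrinfeldModule.map_ascending (S := S[X]) (S' := S'[X]) (q := q)
    (g := fun i => C (g i)) (y := X) (mapRingHom f) i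
  simpa using h

lemma eval_ascending (x : S) (i : ℕ) :
    (ascending q (fun i => C (g i)) (X : S[X]) i).eval x = ascending q g x i := by
  have h := DrinfeldModule.map_ascending (S := S[X]) (S' := S) (q := q)
    (g := fun i => C (g i)) (y := X) (evalRingHom x) i
  simpa using h

end Recursions

section Degrees

variable {L : Type*} [Field L] {q r : ℕ} {g : ℕ → L}

lemma monic_descending (hq : 1 < q) (hg : ∀ i, r < i → g i = 0) (hgr : g r = 1)
    (j i : ℕ) (hj : i + j = r) :
    (descending q r (fun i => C (g i)) (X : L[X]) i).Monic ∧
      (descending q r (fun i => C (g i)) (X : L[X]) i).natDegree =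
        ∑ l ∈ Finset.Ico i r, q ^ l := by
  induction j generalizing i with
  | zero =>
    obtain rfl : i = r := by omega
    rw [descending_eq (fun i hi => by rw [hg i hi, C_0]), descending_of_gt (by omega), hgr]
    simp
  | succ j ih =>
    obtain ⟨h1, h2⟩ := ih (i + 1) (by omega)
    rw [descending_eq (fun i hi => by rw [hg i hi, C_0])]
    have h3 := h1.mul (monic_X_pow (q ^ i))
    have h4 : (descending q r (fun i => C (g i)) (X : L[X]) (i + 1) * X ^ q ^ i).natDegree =
        ∑ l ∈ Finset.Ico i r, q ^ l := by
      rw [h1.natDegree_mul (monic_X_pow _), h2, natDegree_X_pow,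
        Finset.sum_eq_sum_Ico_succ_bot (show i < r by omega), add_comm]
    have h5 : 0 < ∑ l ∈ Finset.Ico i r, q ^ l := by
      rw [Finset.sum_eq_sum_Ico_succ_bot (show i < r by omega)]
      positivity
    have h6 : (C (g i)).natDegree <
        (descending q r (fun i => C (g i)) (X : L[X]) (i + 1) * X ^ q ^ i).natDegree := by
      rw [natDegree_C, h4]
      exact h5
    refine ⟨h3.add_of_right (degree_lt_degree h6), ?_⟩
    rw [natDegree_add_eq_right_of_natDegree_lt h6, h4]

/-- The degrees satisfy d_(i+1) = 1 + q d_i, starting from E_1 = -g_0 y; this is where g_0 ≠ 0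
enters. -/
lemma natDegree_ascending (hq : 1 < q) (hg0 : g 0 ≠ 0) (i : ℕ) :
    (ascending q (fun i => C (g i)) (X : L[X]) (i + 1)).natDegree =
      ∑ l ∈ Finset.range (i + 1), q ^ l := by
  induction i with
  | zero =>
    rw [ascending, ascending, zero_pow (by omega), zero_sub, ← C_neg, natDegree_mul_C]
    · simp
    · simpa using hg0
  | succ i ih =>
    rw [ascending, natDegree_X_mul, natDegree_sub_C, natDegree_pow, ih, geom_sum_succ (n := i + 1)]
    intro h
    have h1 := congrArg natDegree h
    rw [natDegree_sub_C, natDegree_pow, ih, natDegree_zero, Finset.sum_range_succ'] at h1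
    simp at h1
    omega

end Degrees

section Polynomials

variable {Fq : Type*} [Field Fq] [Fintype Fq] {L : Type*} [Field L] [Algebra Fq L]
  {r : ℕ} {g : ℕ → L}

local notation "q" => Fintype.card Fq

lemma _root_.Polynomial.derivative_X_pow_card_pow (Fq : Type*) [Field Fq] [Fintype Fq]
    {B : Type*} [CommRing B] [Algebra Fq B] {m : ℕ} (hm : m ≠ 0) :
    derivative (X ^ Fintype.card Fq ^ m : B[X]) = 0 := by
  rw [derivative_X_pow]
  obtain ⟨n, rfl⟩ := Nat.exists_eq_succ_of_ne_zero hm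
  rw [pow_succ]
  push_cast
  rw [FiniteField.card_cast_eq_zero Fq]
  simp

/-- For i ≥ 1 the polynomial k_i has zero derivative, because k_(i+1) has and X is raised to a
positive power of q. So k_0 = g_0 + k_1 X has derivative k_1, and k_0 - X k_1 = g_0 is a unit. -/
lemma separable_descending (hg : ∀ i, r < i → g i = 0) (hg0 : g 0 ≠ 0) :
    (descending q r (fun i => C (g i)) (X : L[X]) 0).Separable := by
  have hd : ∀ j i, i + j = r + 1 → 1 ≤ i →
      derivative (descending q r (fun i => C (g i)) (X : L[X]) i) = 0 := by
    intro j
    induction j with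
    | zero =>
      intro i hi _
      rw [descending_of_gt (by omega), derivative_zero]
    | succ j ih =>
      intro i hi h1
      rw [descending_eq (fun i hi => by rw [hg i hi, C_0]), derivative_add, derivative_mul,
        ih (i + 1) (by omega) (by omega), derivative_C,
        derivative_X_pow_card_pow Fq (by omega : i ≠ 0)]
      simp
  have h0 : descending q r (fun i => C (g i)) (X : L[X]) 0 = C (g 0) +
      descending q r (fun i => C (g i)) (X : L[X]) 1 * X ^ q ^ 0 :=
    descending_eq (fun i hi => by rw [hg i hi, C_0]) 0
  rw [pow_zero, pow_one] at h0
  have h1 : derivative (descending q r (fun i => C (g i)) (X : L[X]) 0) =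
      descending q r (fun i => C (g i)) (X : L[X]) 1 := by
    rw [h0, derivative_add, derivative_mul, hd r 1 (by omega) le_rfl]
    simp
  rw [Separable, h1]
  refine ⟨C (g 0)⁻¹, -C (g 0)⁻¹ * X, ?_⟩
  rw [h0]
  have h2 : C (g 0)⁻¹ * C (g 0) = (1 : L[X]) := by rw [← C_mul, inv_mul_cancel₀ hg0, C_1]
  linear_combination h2

/-- With N = X (E_(r-1)^q - g_(r-1)) - 1, the q-th power has zero derivative, so X N' - N = 1. -/
lemma separable_ascending (hr : r ≠ 0) :
    (ascending q (fun i => C (g i)) (X : L[X]) r - 1).Separable := by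
  obtain ⟨m, rfl⟩ := Nat.exists_eq_succ_of_ne_zero hr
  have h1 : derivative (ascending q (fun i => C (g i)) (X : L[X]) (m + 1) - 1) =
      ascending q (fun i => C (g i)) (X : L[X]) m ^ q - C (g m) := by
    rw [ascending, derivative_sub, derivative_mul, derivative_sub, derivative_pow,
      FiniteField.card_cast_eq_zero Fq]
    simp
  rw [Separable, h1]
  refine ⟨-1, X, ?_⟩
  rw [ascending]
  ring

end Polynomials

end DrinfeldModule

/-! ### The isogenies with kernel of dimension or codimension one -/

lemma Polynomial.eq_zero_of_natDegree_lt_natCard {K : Type*} [Field K] {p : K[X]} {P : K → Prop}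
    (h : ∀ x, P x → p.eval x = 0) (hc : p.natDegree < Nat.card {x // P x}) : p = 0 := by
  have hfin : Finite {x // P x} := Nat.finite_of_card_ne_zero (by omega)
  have := Fintype.ofFinite {x // P x}
  rw [Nat.card_eq_fintype_card] at hc
  exact eq_zero_of_natDegree_lt_card_of_eval_eq_zero p (f := Subtype.val)
    Subtype.val_injective (fun x => h _ x.2) hc

namespace DrinfeldModule

variable {Fq : Type*} [Field Fq] [Fintype Fq] {L : Type*} [Field L] [Algebra Fq[X] L]
  {r : ℕ}

local notation "q" => Fintype.card Fq

lemma coeff_zero_ne_zero (hinj : Function.Injective (algebraMap Fq[X] L))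
    (φ : DrinfeldModule Fq L r) : φ.coeff 0 ≠ 0 := by
  rw [φ.coeff_zero]
  exact (map_ne_zero_iff _ hinj).2 X_ne_zero

variable [Algebra Fq L]

section Descending

variable {φ : DrinfeldModule Fq L r} {k : ℕ → L} {z : L}

lemma poly_eq_of_descending (hk : ∀ i, k i = φ.coeff i + k (i + 1) * z ^ q ^ i)
    (hkr : ∀ i, r < i → k i = 0) :
    φ.poly = (qPoly q r fun i => k (i + 1)).comp (X ^ q - C z * X) + C (k 0) * X := by
  rw [qPoly_comp_X_pow_sub_C_mul_X Fq r k z (hkr _ (by omega)), poly_eq_qPoly]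
  exact qPoly_congr fun i _ => by rw [hk i]; ring

/-- The isogeny `X^q - z X`, for `φ_T = (∑ k_(i+1) X^(q^i)) ∘ (X^q - z X)`. -/
def Isogeny.ofDescending (hr : φ.coeff r = 1) (hk : ∀ i, k i = φ.coeff i + k (i + 1) * z ^ q ^ i)
    (hkr : ∀ i, r < i → k i = 0) (hk0 : k 0 = 0) : φ.Isogeny where
  target :=
    { coeff := fun i => k i ^ q - z * k (i + 1)
      coeff_zero := by
        have h := hk 0
        rw [hk0, φ.coeff_zero, pow_zero, pow_one] at h
        rw [hk0, zero_pow Fintype.card_ne_zero]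
        linear_combination h
      coeff_rank := by
        rw [hk r, hkr (r + 1) (by omega), hr]
        simp
      coeff_gt := fun i hi => by
        rw [hkr i hi, hkr (i + 1) (by omega), zero_pow Fintype.card_ne_zero]
        simp }
  f := X ^ q - C z * X
  f_linear n hn := by
    rw [X_pow_sub_C_mul_X_eq_qPoly] at hn
    exact qPoly_coeff_exponent _ _ _ hn
  f_ne_zero := by
    intro h
    have h1 := congrArg (fun p => p.coeff (q ^ 1)) h
    rw [X_pow_sub_C_mul_X_eq_qPoly, coeff_qPoly Fintype.one_lt_card] at h1
    simp at h1
  f_comm := by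
    have h := poly_eq_of_descending hk hkr
    rw [hk0, C_0, zero_mul, add_zero] at h
    rw [h, ← comp_assoc, X_pow_sub_C_mul_X_comp_qPoly Fq r k z hk0 (hkr _ (by omega))]
    rfl

lemma Isogeny.ofDescending_isOfType [IsAlgClosed L]
    (hinj : Function.Injective (algebraMap Fq[X] L)) (hr1 : 1 ≤ r) (hr : φ.coeff r = 1)
    (hk : ∀ i, k i = φ.coeff i + k (i + 1) * z ^ q ^ i)
    (hkr : ∀ i, r < i → k i = 0) (hk0 : k 0 = 0) :
    (Isogeny.ofDescending hr hk hkr hk0).IsOfType X (standardSubmodule X r 1) := by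
  have hz : z ≠ 0 := by
    rintro rfl
    have h := hk 0
    rw [hk0, pow_zero, pow_one, mul_zero, add_zero] at h
    exact φ.coeff_zero_ne_zero hinj h.symm
  refine Isogeny.isOfType_X hinj _ hr1 (fun x hx => ?_) ?_
  · have hx' : (X ^ q - C z * X : L[X]).eval x = 0 := hx
    rw [poly_eq_of_descending hk hkr, hk0, C_0, zero_mul, add_zero, eval_comp, hx']
    simp [qPoly, eval_finsetSum]
  · have h := natCard_roots_qPoly (Fq := Fq) (L := L) (n := 1)
      (a := fun i => if i = 0 then -z else 1) (by simpa using hz) (by simp)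
    rw [← X_pow_sub_C_mul_X_eq_qPoly] at h
    exact h

/-- Every isogeny of type `A/TA` is a multiple of some `X^q - z X`. -/
lemma Isogeny.IsOfType.exists_eq_descending [IsAlgClosed L]
    (hinj : Function.Injective (algebraMap Fq[X] L)) (hr1 : 1 ≤ r) (a : φ.Isogeny)
    (ha : a.IsOfType X (standardSubmodule X r 1)) :
    ∃ (u : Lˣ) (z : L), a.f = C (u : L) * (X ^ q - C z * X) ∧
      descending q r φ.coeff z 0 = 0 := by
  have hq : 1 < q := Fintype.one_lt_card
  have hcard : Nat.card {x // a.f.eval x = 0} = q ^ 1 := by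
    rw [ha.natCard_roots, natCard_standardSubmodule Fq hr1, Nat.card_eq_fintype_card]
  have hdeg := a.natDegree_eq_of_natCard hinj hcard
  have hf := eq_qPoly hq a.f_linear (n := 2) (hdeg ▸ Nat.pow_lt_pow_right hq (by omega))
  have hlead : a.f.coeff (q ^ 1) ≠ 0 := by
    rw [← hdeg]
    simpa using a.f_ne_zero
  let z := -(a.f.coeff (q ^ 0) / a.f.coeff (q ^ 1))
  have haf : a.f = C (a.f.coeff (q ^ 1)) * (X ^ q - C z * X) := by
    rw [X_pow_sub_C_mul_X_eq_qPoly, C_mul_qPoly]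
    refine hf.trans (qPoly_congr fun i hi => ?_)
    rcases (by omega : i = 0 ∨ i = 1) with rfl | rfl
    · simp only [if_true, z]
      field_simp
    · simp
  refine ⟨Units.mk0 _ hlead, z, haf, ?_⟩
  -- A nonzero kernel element x satisfies x^q = z x, so evaluating the right division of phi_T at x
  -- leaves k_0 x = 0.
  obtain ⟨x, hx, hx0⟩ : ∃ x, a.f.eval x = 0 ∧ x ≠ 0 := by
    by_contra! h
    have h1 : Subsingleton {x // a.f.eval x = 0} :=
      ⟨fun x y => Subtype.ext ((h _ x.2).trans (h _ y.2).symm)⟩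
    have h2 := Finite.card_le_one_iff_subsingleton.2 h1
    rw [hcard, pow_one] at h2
    omega
  have h1 := ha.eval_poly_eq_zero hx
  rw [haf, eval_mul, eval_C] at hx
  have hx' := (mul_eq_zero.1 hx).resolve_left hlead
  rw [poly_eq_of_descending (φ := φ) (descending_eq (z := z) φ.coeff_gt)
    (fun i hi => descending_of_gt hi), eval_add, eval_comp, hx'] at h1
  have h2 : (qPoly q r fun i => descending q r φ.coeff z (i + 1)).eval 0 = 0 := by
    simp [qPoly, eval_finsetSum]
  rw [h2, zero_add, eval_mul, eval_C, eval_X] at h1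
  exact (mul_eq_zero.1 h1).resolve_right hx0

end Descending

section Ascending

variable {φ : DrinfeldModule Fq L r} {E : ℕ → L} {c : L}

lemma poly_eq_of_ascending (hE : ∀ i, E i ^ q = φ.coeff i + c * E (i + 1)) (hE0 : E 0 = 0)
    (hEr : ∀ i, r < i → E i = 0) :
    φ.poly = (X ^ q - C c * X).comp (qPoly q r fun i => E (i + 1)) := by
  rw [X_pow_sub_C_mul_X_comp_qPoly Fq r E c hE0 (hEr _ (by omega)), poly_eq_qPoly]
  exact qPoly_congr fun i _ => by rw [hE i]; ring

/-- The isogeny `∑ E_(i+1) X^(q^i)`, for `φ_T = (X^q - c X) ∘ (∑ E_(i+1) X^(q^i))`. -/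
def Isogeny.ofAscending (hr : r ≠ 0) (hE : ∀ i, E i ^ q = φ.coeff i + c * E (i + 1))
    (hE0 : E 0 = 0) (hE1 : E r = 1) (hEr : ∀ i, r < i → E i = 0) : φ.Isogeny where
  target :=
    { coeff := fun i => E i - E (i + 1) * c ^ q ^ i
      coeff_zero := by
        have h := hE 0
        rw [hE0, φ.coeff_zero, zero_pow Fintype.card_ne_zero] at h
        rw [hE0, pow_zero, pow_one]
        linear_combination h
      coeff_rank := by
        rw [hE1, hEr (r + 1) (by omega)]
        simp
      coeff_gt := fun i hi => by
        rw [hEr i hi, hEr (i + 1) (by omega)]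
        simp }
  f := qPoly q r fun i => E (i + 1)
  f_linear n hn := qPoly_coeff_exponent _ _ _ hn
  f_ne_zero := by
    intro h
    obtain ⟨m, rfl⟩ := Nat.exists_eq_succ_of_ne_zero hr
    have h1 := congrArg (fun p => p.coeff (q ^ m)) h
    simp [coeff_qPoly (Fintype.one_lt_card (α := Fq)), hE1] at h1
  f_comm := by
    rw [poly_eq_of_ascending hE hE0 hEr, ← comp_assoc]
    congr 1
    have h := qPoly_comp_X_pow_sub_C_mul_X Fq r E c (hEr _ (by omega))
    rw [hE0, C_0, zero_mul, add_zero] at h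
    exact h

lemma Isogeny.ofAscending_isOfType [IsAlgClosed L]
    (hinj : Function.Injective (algebraMap Fq[X] L)) (hr : r ≠ 0)
    (hE : ∀ i, E i ^ q = φ.coeff i + c * E (i + 1))
    (hE0 : E 0 = 0) (hE1 : E r = 1) (hEr : ∀ i, r < i → E i = 0) :
    (Isogeny.ofAscending hr hE hE0 hE1 hEr).IsOfType X (standardSubmodule X r (r - 1)) := by
  have hE1' : E 1 ≠ 0 := by
    intro h1
    have h := hE 0
    rw [hE0, h1, zero_pow Fintype.card_ne_zero, mul_zero, add_zero] at h
    exact φ.coeff_zero_ne_zero hinj h.symm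
  refine Isogeny.isOfType_X hinj _ (Nat.sub_le _ _) (fun x hx => ?_) ?_
  · have hx' : (qPoly q r fun i => E (i + 1)).eval x = 0 := hx
    rw [poly_eq_of_ascending hE hE0 hEr, eval_comp, hx']
    simp
  · obtain ⟨m, rfl⟩ := Nat.exists_eq_succ_of_ne_zero hr
    exact natCard_roots_qPoly (Fq := Fq) (L := L) (n := m) (a := fun i => E (i + 1)) hE1'
      (by rw [hE1]; exact one_ne_zero)

/-- Every isogeny of type `(A/TA)^(r-1)` is a multiple of some `∑ E_(i+1) X^(q^i)`. -/
lemma Isogeny.IsOfType.exists_eq_ascending [IsAlgClosed L]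
    (hinj : Function.Injective (algebraMap Fq[X] L)) (hr2 : 2 ≤ r) (hφ : φ.coeff r = 1)
    (a : φ.Isogeny) (ha : a.IsOfType X (standardSubmodule X r (r - 1))) :
    ∃ (u : Lˣ) (y : L), a.f = C (u : L) * (qPoly q r fun i => ascending q φ.coeff y (i + 1)) ∧
      ascending q φ.coeff y r = 1 := by
  have hq : 1 < q := Fintype.one_lt_card
  obtain ⟨m, rfl⟩ : ∃ m, r = m + 1 + 1 := ⟨r - 2, by omega⟩
  rw [Nat.add_sub_cancel] at ha
  have hcard : Nat.card {x // a.f.eval x = 0} = q ^ (m + 1) := by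
    rw [ha.natCard_roots, natCard_standardSubmodule Fq (by omega), Nat.card_eq_fintype_card]
  have hdeg := a.natDegree_eq_of_natCard hinj hcard
  have hf := eq_qPoly hq a.f_linear (n := m + 1 + 1)
    (hdeg ▸ Nat.pow_lt_pow_right hq (by omega))
  have hlead : a.f.coeff (q ^ (m + 1)) ≠ 0 := by
    rw [← hdeg]
    simpa using a.f_ne_zero
  set l := a.f.coeff (q ^ (m + 1)) with hl
  -- Here E_i is the coefficient of X^(q^(i-1)) in the monic multiple of f. The values 0 at i = 0
  -- and above r make the recursion hold at every index.
  let E : ℕ → L := fun i => if i = 0 then 0 else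
    if i ≤ m + 1 + 1 then a.f.coeff (q ^ (i - 1)) / l else 0
  have hE0 : E 0 = 0 := if_pos rfl
  have hE1 : E (m + 1 + 1) = 1 := by
    simp only [E]
    rw [if_neg (by omega), if_pos le_rfl, Nat.add_sub_cancel, ← hl, div_self hlead]
  have hEr : ∀ i, m + 1 + 1 < i → E i = 0 := fun i hi => by
    simp only [E]
    rw [if_neg (by omega), if_neg (by omega)]
  have haf : a.f = C l * qPoly q (m + 1 + 1) fun i => E (i + 1) := by
    rw [C_mul_qPoly]
    refine hf.trans (qPoly_congr fun i hi => ?_)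
    simp only [E]
    rw [if_neg (by omega), if_pos (by omega), Nat.add_sub_cancel, mul_div_cancel₀ _ hlead]
  -- This c cancels the coefficient of X^(q^(r-1)), where r - 1 = m + 1; that of X^(q^r) cancels
  -- since both polynomials are monic.
  let c := E (m + 1) ^ q - φ.coeff (m + 1)
  let d : ℕ → L := fun i => φ.coeff i - (E i ^ q - c * E (i + 1))
  have hrem : φ.poly - (X ^ q - C c * X).comp (qPoly q (m + 1 + 1) fun i => E (i + 1)) =
      qPoly q (m + 1) d := by
    rw [X_pow_sub_C_mul_X_comp_qPoly Fq (m + 1 + 1) E c hE0 (hEr _ (by omega)), poly_eq_qPoly,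
      qPoly_sub, qPoly_succ, qPoly_succ]
    have h1 : φ.coeff (m + 1) - (E (m + 1) ^ q - c * E (m + 1 + 1)) = 0 := by
      rw [hE1]
      simp only [c]
      ring
    have h2 : φ.coeff (m + 1 + 1) - (E (m + 1 + 1) ^ q - c * E (m + 1 + 1 + 1)) = 0 := by
      rw [hE1, hφ, hEr (m + 1 + 1 + 1) (by omega)]
      simp
    rw [h1, h2]
    simp [d]
  -- The remainder has degree at most q^(r-2), yet it vanishes on the q^(r-1) elements of the
  -- kernel.
  have hrem0 : qPoly q (m + 1) d = 0 := by
    refine eq_zero_of_natDegree_lt_natCard (P := fun x => a.f.eval x = 0) (fun x hx => ?_) ?_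
    · rw [← hrem, eval_sub, ha.eval_poly_eq_zero hx, eval_comp]
      rw [haf, eval_mul, eval_C] at hx
      rw [(mul_eq_zero.1 hx).resolve_left hlead]
      simp
    · rw [hcard]
      exact (natDegree_qPoly_le hq m d).trans_lt (Nat.pow_lt_pow_right hq (by omega))
  have hE : ∀ i, E i ^ q = φ.coeff i + c * E (i + 1) := by
    intro i
    rcases le_or_gt i (m + 1 + 1) with hi | hi
    · rw [hrem0, X_pow_sub_C_mul_X_comp_qPoly Fq (m + 1 + 1) E c hE0 (hEr _ (by omega)),
        poly_eq_qPoly, qPoly_sub] at hrem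
      have h1 := congrArg (fun p => p.coeff (q ^ i)) hrem
      rw [coeff_qPoly hq, if_pos (by omega), Polynomial.coeff_zero] at h1
      linear_combination -h1
    · rw [hEr i hi, hEr (i + 1) (by omega), φ.coeff_gt i hi, zero_pow (by omega)]
      simp
  have hc : c ≠ 0 := by
    intro hc
    have h := hE 0
    rw [hE0, hc, zero_pow (by omega), zero_mul, add_zero] at h
    exact φ.coeff_zero_ne_zero hinj h.symm
  have hasc : ∀ i, ascending q φ.coeff c⁻¹ i = E i := by
    intro i
    induction i with
    | zero => rw [ascending, hE0]
    | succ i ih => rw [ascending, ih, hE i, add_sub_cancel_left, inv_mul_cancel_left₀ hc]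
  refine ⟨Units.mk0 l hlead, c⁻¹, ?_, by rw [hasc, hE1]⟩
  simp only [hasc]
  exact haf

end Ascending

end DrinfeldModule

/-! ### The monic generic Drinfeld module -/

namespace DrinfeldModule

section Generic

variable (Fq : Type*) [Field Fq] (r : ℕ)

/-- The coefficients of the monic generic Drinfeld module, as elements of `A[g₁, …, g_(r-1)]`. -/
def genericCoeff (i : ℕ) : CoeffRing Fq r :=
  if i = 0 then varT Fq r
  else if h : 0 < i ∧ i < r then MvPolynomial.X ⟨i - 1, by omega⟩
  else if i = r then 1 else 0

lemma monicGeneric_coeff [Fintype Fq] (hr : 2 ≤ r) (i : ℕ) :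
    (monicGeneric Fq r hr).coeff i = algebraMap _ _ (genericCoeff Fq r i) := by
  simp only [monicGeneric, genericCoeff]
  split_ifs with h0 h1 h2 h3 h4 h5 h6
  · rw [IsScalarTower.algebraMap_apply Fq[X] (CoeffRing Fq r) (GenericField Fq r)]
    rfl
  all_goals first | rfl | omega | simp

variable {Fq r}

lemma degT_genericCoeff {i : ℕ} (hi : 1 ≤ i) : degT (genericCoeff Fq r i) = 0 := by
  refine Nat.le_zero.1 (degT_le_iff.2 fun m => ?_)
  rw [genericCoeff, if_neg (by omega)]
  split_ifs
  · rw [MvPolynomial.coeff_X]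
    split_ifs <;> simp
  · rw [MvPolynomial.coeff_one]
    split_ifs <;> simp
  · simp

lemma algebraMap_polynomial_genericField_injective :
    Function.Injective (algebraMap Fq[X] (GenericField Fq r)) := by
  rw [IsScalarTower.algebraMap_eq Fq[X] (CoeffRing Fq r) (GenericField Fq r)]
  exact algebraMap_genericField_injective.comp (MvPolynomial.C_injective _ _)

lemma valuation_genericCoeff_le_one {Γ : Type*} [LinearOrderedCommGroupWithZero Γ]
    {v : Valuation (GenericField Fq r) Γ} (hv : ∀ p : CoeffRing Fq r, p ≠ 0 →
      v (algebraMap _ _ p) = v (algebraMap _ _ (varT Fq r)) ^ degT p) {i : ℕ} (hi : 1 ≤ i) :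
    v (algebraMap _ _ (genericCoeff Fq r i)) ≤ 1 := by
  by_cases h : genericCoeff Fq r i = 0
  · rw [h, map_zero, map_zero]
    exact zero_le_one
  · rw [hv _ h, degT_genericCoeff hi, pow_zero]

end Generic

lemma valuation_prod_le_one {L Γ : Type*} [Field L] [LinearOrderedCommGroupWithZero Γ]
    (v : Valuation L Γ) {s : Finset ℕ} {f : ℕ → L} (e : ℕ → ℕ) (h : ∀ i ∈ s, v (f i) ≤ 1) :
    v (∏ i ∈ s, f i ^ e i) ≤ 1 := by
  rw [map_prod]
  refine Finset.prod_le_one' fun i hi => ?_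
  rw [map_pow]
  exact pow_le_one' (h i hi) _

/-- The finite set of roots of a separable polynomial over an algebraically closed field. -/
lemma _root_.Polynomial.Separable.exists_finset_roots {L : Type*} [Field L] [IsAlgClosed L]
    {N : L[X]} (hN : N.Separable) :
    ∃ Z : Finset L, (∀ z, z ∈ Z ↔ N.eval z = 0) ∧ Z.card = N.natDegree := by
  classical
  refine ⟨N.roots.toFinset, fun z => ?_, ?_⟩
  · rw [Multiset.mem_toFinset, mem_roots hN.ne_zero, IsRoot]
  · rw [Multiset.toFinset_card_of_nodup (nodup_roots hN),
      (IsAlgClosed.splits N).natDegree_eq_card_roots]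

section Main

variable {Fq : Type*} [Field Fq] [Fintype Fq] {r : ℕ} {e : ℕ → ℕ}

local notation "q" => Fintype.card Fq

lemma monicGeneric_coeff_rank (hr : 2 ≤ r) : (monicGeneric Fq r hr).coeff r = 1 := by
  have h : r ≠ 0 := by omega
  simp [monicGeneric, h]

theorem exists_modularPolynomial_one (hr : 2 ≤ r)
    (he : ∑ i ∈ Finset.Ico 1 r, e i * (q ^ i - 1) = e r * (q ^ r - 1)) {w : ℕ}
    (hw : (w : ℤ) = weightOne q r e) :
    ∃ P : (CoeffRing Fq r)[X], P.map (algebraMap _ (GenericField Fq r)) =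
        (monicGeneric Fq r hr).modularPolynomial (evalMonomial e) X (standardSubmodule X r 1) ∧
      P.natDegree = ∑ l ∈ Finset.range r, q ^ l ∧ P.coeff 0 ≠ 0 ∧
      degT (P.coeff 0) = (∑ l ∈ Finset.range r, q ^ l) * w ∧
      (∀ k ≤ ∑ l ∈ Finset.range r, q ^ l,
        degT (P.coeff k) ≤ (∑ l ∈ Finset.range r, q ^ l - k) * w) ∧
      height P = (∑ l ∈ Finset.range r, q ^ l) * w := by
  have hq : 1 < q := Fintype.one_lt_card
  have hinj := algebraMap_polynomial_genericField_injective (Fq := Fq) (r := r)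
  set φ := monicGeneric Fq r hr with hφ
  have hφr : φ.coeff r = 1 := monicGeneric_coeff_rank hr
  have hφ0 : φ.coeff 0 = algebraMap _ _ (varT Fq r) := by
    rw [hφ, monicGeneric_coeff, genericCoeff, if_pos rfl]
  let ι := algebraMap (CoeffRing Fq r) (GenericField Fq r)
  let N := descending q r (fun i => C (genericCoeff Fq r i)) X 0
  have hmap : ∀ i, (descending q r (fun i => C (genericCoeff Fq r i)) X i).map ι =
      descending q r (fun i => C (φ.coeff i)) X i := fun i => by
    rw [map_C_descending]
    simp only [hφ, monicGeneric_coeff, ι]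
  have heval : ∀ i z, (descending q r (fun i => C (φ.coeff i)) X i).eval z =
      descending q r φ.coeff z i := fun i z =>
    eval_descending z i
  have hNsep : (N.map ι).Separable := by
    rw [hmap]
    exact separable_descending φ.coeff_gt (φ.coeff_zero_ne_zero hinj)
  obtain ⟨Z, hZ, hZcard⟩ := hNsep.exists_finset_roots
  have hZ' : ∀ z, z ∈ Z ↔ descending q r φ.coeff z 0 = 0 := fun z => by
    rw [hZ, hmap, heval]
  rw [hmap, (monic_descending hq φ.coeff_gt hφr r 0 (by omega)).2, ← Finset.range_eq_Ico]
    at hZcard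
  let j : GenericField Fq r → GenericField Fq r := fun z => ∏ i ∈ Finset.Ico 1 r,
    (descending q r φ.coeff z i ^ q - z * descending q r φ.coeff z (i + 1)) ^ e i
  let G : (CoeffRing Fq r)[X] := ∏ i ∈ Finset.Ico 1 r,
    (descending q r (fun i => C (genericCoeff Fq r i)) X i ^ q -
      X * descending q r (fun i => C (genericCoeff Fq r i)) X (i + 1)) ^ e i
  have hj : ∀ z, j z = (G.map ι).eval z := fun z => by
    simp only [j, G, Polynomial.map_prod, Polynomial.map_pow, Polynomial.map_sub,
      Polynomial.map_mul, map_X, hmap, eval_prod, eval_pow, eval_sub, eval_mul, eval_X, heval]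
  have hk : ∀ z i, descending q r φ.coeff z i =
      φ.coeff i + descending q r φ.coeff z (i + 1) * z ^ q ^ i :=
    fun z => descending_eq φ.coeff_gt
  have hg0 : ∀ z ∈ Z, φ.coeff 0 = -(descending q r φ.coeff z 1 * z) := fun z hz => by
    have h := hk z 0
    rw [(hZ' z).1 hz, pow_zero, pow_one] at h
    linear_combination -h
  have hprod : φ.modularPolynomial (evalMonomial e) X (standardSubmodule X r 1) =
      ∏ z ∈ Z, (X - C (j z)) := by
    refine φ.modularPolynomial_eq_prod he X _ Z (fun z => Isogeny.ofDescending hφr (hk z)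
      (fun i hi => descending_of_gt hi) ((hZ' z).1 z.2)) j (fun z => ?_) (fun z => ?_)
      (fun z z' h => ?_) fun a ha => ?_
    · have h1 : (descending q r φ.coeff z r ^ q - z * descending q r φ.coeff z (r + 1)) = 1 := by
        rw [hk z r, descending_of_gt (by omega : r < r + 1), hφr]
        simp
      have h2 : ∀ x : GenericField Fq r, x * ((descending q r φ.coeff z r ^ q -
          z * descending q r φ.coeff z (r + 1)) ^ e r)⁻¹ = x := fun x => by
        rw [h1, one_pow, inv_one, mul_one]
      exact h2 _
    · exact Isogeny.ofDescending_isOfType hinj (by omega) hφr _ _ _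
    -- The leading coefficients force u = 1, after which the linear coefficients give z = z'.
    · obtain ⟨u, -, hu⟩ := h
      have hu' : (X ^ q - C (z' : GenericField Fq r) * X) = C (u : GenericField Fq r) *
        (X ^ q - C (z : GenericField Fq r) * X) := hu
      rw [X_pow_sub_C_mul_X_eq_qPoly, X_pow_sub_C_mul_X_eq_qPoly, C_mul_qPoly] at hu'
      have h0 := congrArg (fun p => p.coeff (q ^ 0)) hu'
      have h1 := congrArg (fun p => p.coeff (q ^ 1)) hu'
      simp only [coeff_qPoly hq] at h0 h1
      simp at h0 h1
      rw [← h1, one_mul] at h0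
      exact Subtype.ext h0.symm
    · obtain ⟨u, z, hf, hz⟩ := Isogeny.IsOfType.exists_eq_descending hinj (by omega) a ha
      refine ⟨⟨z, (hZ' z).2 hz⟩, Isogeny.rel_of_eq_C_mul _ a u hf ?_⟩
      change (X ^ q - C z * X : (GenericField Fq r)[X]).natDegree ≠ 0
      rw [X_pow_sub_C_mul_X_eq_qPoly, natDegree_qPoly hq 1 _ (by simp)]
      positivity
  have hmain := exists_coeffRing_polynomial (N := N) (G := G) hNsep hZ (j := j)
    (fun z _ => hj z) (fun z hz => ?_) (w := w) (fun V ht hV z hz => ?_)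
  · rw [← hprod, hZcard] at hmain
    exact hmain
  · refine isIntegral_of_forall_valuation_le_one fun V hV => ?_
    have hg : ∀ i, V.valuation (φ.coeff i) ≤ 1 := fun i => by
      rw [hφ, monicGeneric_coeff]
      exact hV _
    -- If v(z) > 1, then T = -k_1 z would have value greater than 1, although v ≤ 1 on the
    -- coefficient ring.
    have hz1 : V.valuation z ≤ 1 := by
      by_contra! h
      have h1 := valuation_descending_eq V.valuation (hk z) (descending_of_gt r.lt_succ_self)
        (fun i _ => hg i) hφr (by omega) h 1 le_rfl (by omega)
      have h2 := hg 0
      rw [hg0 z hz, Valuation.map_neg, map_mul, h1, ← pow_succ] at h2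
      exact absurd h2 (not_le.2 (one_lt_pow₀ h (by omega)))
    have hk1 := valuation_descending_le_one V.valuation (hk z) (descending_of_gt r.lt_succ_self)
      (fun i _ => hg i) hz1
    refine valuation_prod_le_one _ _ fun i hi => ?_
    rw [Finset.mem_Ico] at hi
    refine (Valuation.map_sub _ _ _).trans (max_le ?_ ?_)
    · rw [map_pow]
      exact pow_le_one' (hk1 i hi.1 (by omega)) _
    · rw [map_mul]
      exact mul_le_one' hz1 (hk1 (i + 1) (by omega) (by omega))
  · have hg : ∀ i, 1 ≤ i → V.valuation (φ.coeff i) ≤ 1 := fun i hi => by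
      rw [hφ, monicGeneric_coeff]
      exact valuation_genericCoeff_le_one hV hi
    -- If v(z) ≤ 1, then v(k_1) ≤ 1 and T = -k_1 z would have value at most 1.
    have hz1 : 1 < V.valuation z := by
      by_contra! h
      have h1 := valuation_descending_le_one V.valuation (hk z) (descending_of_gt r.lt_succ_self)
        hg h 1 le_rfl (by omega)
      rw [← hφ0, hg0 z hz, Valuation.map_neg, map_mul] at ht
      exact absurd ht (not_lt.2 (mul_le_one' h1 h))
    have ht' : V.valuation (algebraMap _ _ (varT Fq r)) =
        V.valuation z ^ ∑ l ∈ Finset.range r, q ^ l := by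
      rw [← hφ0, hg0 z hz, Valuation.map_neg, map_mul, valuation_descending_eq V.valuation (hk z)
        (descending_of_gt r.lt_succ_self) hg hφr (by omega) hz1 1 le_rfl (by omega), ← pow_succ,
        Finset.range_eq_Ico, Finset.sum_eq_sum_Ico_succ_bot (by omega : 0 < r), add_comm, pow_zero]
    rw [ht', ← pow_mul, ← sum_mul_weightOne hq he hw, map_prod, ← Finset.prod_pow_eq_pow_sum]
    refine Finset.prod_congr rfl fun i hi => ?_
    rw [Finset.mem_Ico] at hi
    rw [map_pow, valuation_target_descending V.valuation (hk z) (descending_of_gt r.lt_succ_self) hg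
      hφr hq hz1 i hi.1 hi.2, ← pow_mul]

theorem exists_modularPolynomial_corank_one (hr : 2 ≤ r)
    (he : ∑ i ∈ Finset.Ico 1 r, e i * (q ^ i - 1) = e r * (q ^ r - 1)) {w : ℕ}
    (hw : (w : ℤ) = weightCorank q r e) :
    ∃ P : (CoeffRing Fq r)[X], P.map (algebraMap _ (GenericField Fq r)) =
        (monicGeneric Fq r hr).modularPolynomial (evalMonomial e) X
          (standardSubmodule X r (r - 1)) ∧
      P.natDegree = ∑ l ∈ Finset.range r, q ^ l ∧ P.coeff 0 ≠ 0 ∧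
      degT (P.coeff 0) = (∑ l ∈ Finset.range r, q ^ l) * w ∧
      (∀ k ≤ ∑ l ∈ Finset.range r, q ^ l,
        degT (P.coeff k) ≤ (∑ l ∈ Finset.range r, q ^ l - k) * w) ∧
      height P = (∑ l ∈ Finset.range r, q ^ l) * w := by
  have hq : 1 < q := Fintype.one_lt_card
  have hinj := algebraMap_polynomial_genericField_injective (Fq := Fq) (r := r)
  have hr0 : r ≠ 0 := by omega
  set φ := monicGeneric Fq r hr with hφ
  have hφr : φ.coeff r = 1 := monicGeneric_coeff_rank hr
  have hφ0 : φ.coeff 0 = algebraMap _ _ (varT Fq r) := by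
    rw [hφ, monicGeneric_coeff, genericCoeff, if_pos rfl]
  have hφ0' := φ.coeff_zero_ne_zero hinj
  let ι := algebraMap (CoeffRing Fq r) (GenericField Fq r)
  let N := ascending q (fun i => C (genericCoeff Fq r i)) X r - 1
  have hmap : ∀ i, (ascending q (fun i => C (genericCoeff Fq r i)) X i).map ι =
      ascending q (fun i => C (φ.coeff i)) X i := fun i => by
    rw [map_C_ascending]
    simp only [hφ, monicGeneric_coeff, ι]
  have heval : ∀ i y, (ascending q (fun i => C (φ.coeff i)) X i).eval y =
      ascending q φ.coeff y i := fun i y =>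
    eval_ascending y i
  have hNmap : N.map ι = ascending q (fun i => C (φ.coeff i)) X r - 1 := by
    rw [Polynomial.map_sub, hmap, Polynomial.map_one]
  have hNsep : (N.map ι).Separable := by
    rw [hNmap]
    exact separable_ascending hr0
  obtain ⟨Z, hZ, hZcard⟩ := hNsep.exists_finset_roots
  have hZ' : ∀ y, y ∈ Z ↔ ascending q φ.coeff y r = 1 := fun y => by
    rw [hZ, hNmap, eval_sub, heval, eval_one, sub_eq_zero]
  have hdeg : (ascending q (fun i => C (φ.coeff i)) (X : (GenericField Fq r)[X]) r).natDegree =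
      ∑ l ∈ Finset.range r, q ^ l := by
    have h := natDegree_ascending hq hφ0' (r - 1)
    rwa [Nat.sub_add_cancel (by omega)] at h
  rw [hNmap, ← C_1, natDegree_sub_C, hdeg] at hZcard
  have hasc0 : ∀ y, ascending q φ.coeff y 0 = 0 := fun y => rfl
  have hascr : ∀ y ∈ Z, ∀ i, r < i → ascending q φ.coeff y i = 0 := fun y hy =>
    ascending_of_gt (by omega) hφr φ.coeff_gt ((hZ' y).1 hy)
  have hy0 : ∀ y ∈ Z, y ≠ 0 := by
    rintro y hy rfl
    have h : ascending q φ.coeff 0 (r - 1 + 1) = 0 := zero_mul _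
    rw [Nat.sub_add_cancel (by omega), (hZ' _).1 hy] at h
    exact one_ne_zero h
  have hE : ∀ y ∈ Z, ∀ i, ascending q φ.coeff y i ^ q =
      φ.coeff i + y⁻¹ * ascending q φ.coeff y (i + 1) := fun y hy i => by
    rw [ascending, inv_mul_cancel_left₀ (hy0 y hy)]
    ring
  -- The end condition E_r = 1 makes c = 1/y a polynomial in y, so that J is the value at y of a
  -- polynomial G over the coefficient ring.
  have hinv : ∀ y ∈ Z, y⁻¹ = ascending q φ.coeff y (r - 1) ^ q - φ.coeff (r - 1) := by
    intro y hy
    rw [hE y hy, Nat.sub_add_cancel (by omega), (hZ' y).1 hy]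
    ring
  have hg0 : ∀ y ∈ Z, φ.coeff 0 = -(y⁻¹ * ascending q φ.coeff y 1) := fun y hy => by
    have h := hE y hy 0
    rw [hasc0, zero_pow (by omega)] at h
    linear_combination -h
  let j : GenericField Fq r → GenericField Fq r := fun y => ∏ i ∈ Finset.Ico 1 r,
    (ascending q φ.coeff y i - ascending q φ.coeff y (i + 1) * y⁻¹ ^ q ^ i) ^ e i
  let G : (CoeffRing Fq r)[X] := ∏ i ∈ Finset.Ico 1 r,
    (ascending q (fun i => C (genericCoeff Fq r i)) X i -
      ascending q (fun i => C (genericCoeff Fq r i)) X (i + 1) *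
        (ascending q (fun i => C (genericCoeff Fq r i)) X (r - 1) ^ q -
          C (genericCoeff Fq r (r - 1))) ^ q ^ i) ^ e i
  have hj : ∀ y ∈ Z, j y = (G.map ι).eval y := fun y hy => by
    simp only [j, G, Polynomial.map_prod, Polynomial.map_pow, Polynomial.map_sub,
      Polynomial.map_mul, map_C, hmap, eval_prod, eval_pow, eval_sub, eval_mul, eval_C, heval]
    rw [hinv y hy, hφ, monicGeneric_coeff]
  have hprod : φ.modularPolynomial (evalMonomial e) X (standardSubmodule X r (r - 1)) =
      ∏ y ∈ Z, (X - C (j y)) := by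
    refine φ.modularPolynomial_eq_prod he X _ Z (fun y => Isogeny.ofAscending hr0 (hE y y.2)
      (hasc0 y) ((hZ' y).1 y.2) (hascr y y.2)) j (fun y => ?_) (fun y => ?_)
      (fun y y' h => ?_) fun a ha => ?_
    · have h2 : ∀ x : GenericField Fq r, x * ((ascending q φ.coeff y r -
          ascending q φ.coeff y (r + 1) * (y : GenericField Fq r)⁻¹ ^ q ^ r) ^ e r)⁻¹ = x :=
        fun x => by
          rw [(hZ' y).1 y.2, hascr y y.2 (r + 1) (by omega), zero_mul, sub_zero, one_pow,
            inv_one, mul_one]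
      exact h2 _
    · exact Isogeny.ofAscending_isOfType hinj hr0 _ _ _ _
    · obtain ⟨u, -, hu⟩ := h
      have hu' : (qPoly q r fun i => ascending q φ.coeff y' (i + 1)) =
        C (u : GenericField Fq r) * qPoly q r fun i => ascending q φ.coeff y (i + 1) := hu
      rw [C_mul_qPoly] at hu'
      -- Both polynomials are monic, so u = 1; the linear coefficient E_1 = -T y then determines y.
      have h1 := congrArg (fun p => p.coeff (q ^ (r - 1))) hu'
      have h0 := congrArg (fun p => p.coeff (q ^ 0)) hu'
      simp only [coeff_qPoly hq] at h0 h1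
      rw [if_pos (by omega), if_pos (by omega), Nat.sub_add_cancel (by omega), (hZ' y).1 y.2,
        (hZ' y').1 y'.2, mul_one] at h1
      rw [if_pos (by omega), if_pos (by omega), ← h1, one_mul, ascending, ascending, ascending,
        ascending, zero_pow (by omega), zero_sub] at h0
      exact Subtype.ext (mul_right_cancel₀ (neg_ne_zero.2 hφ0') h0.symm)
    · obtain ⟨u, y, hf, hy⟩ := Isogeny.IsOfType.exists_eq_ascending hinj hr hφr a ha
      refine ⟨⟨y, (hZ' y).2 hy⟩, Isogeny.rel_of_eq_C_mul _ a u hf ?_⟩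
      change (qPoly q r fun i => ascending q φ.coeff y (i + 1)).natDegree ≠ 0
      obtain ⟨m, hm⟩ : ∃ m, r = m + 1 := ⟨r - 1, by omega⟩
      have h : (qPoly q (m + 1) fun i => ascending q φ.coeff y (i + 1)).natDegree = q ^ m :=
        natDegree_qPoly hq m _ (by rw [← hm, hy]; exact one_ne_zero)
      rw [← hm] at h
      rw [h]
      positivity
  have hmain := exists_coeffRing_polynomial (N := N) (G := G) hNsep hZ (j := j)
    hj (fun y hy => ?_) (w := w) (fun V ht hV y hy => ?_)
  · rw [← hprod, hZcard] at hmain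
    exact hmain
  · refine isIntegral_of_forall_valuation_le_one fun V hV => ?_
    have hg : ∀ i, V.valuation (φ.coeff i) ≤ 1 := fun i => by
      rw [hφ, monicGeneric_coeff]
      exact hV _
    -- If v(c) > 1, then v(E_1) ≥ 1 and T = -c E_1 would have value greater than 1.
    have hc : V.valuation y⁻¹ ≤ 1 := by
      by_contra! h
      have h1 := one_le_valuation_ascending V.valuation (hE y hy) ((hZ' y).1 hy)
        (fun i _ => hg i) (by omega) h 1 le_rfl (by omega)
      have h2 := hg 0
      rw [hg0 y hy, Valuation.map_neg, map_mul] at h2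
      exact absurd h2 (not_le.2 (one_lt_mul_of_lt_of_le' h h1))
    have hE1 := valuation_ascending_le_one V.valuation (hE y hy) ((hZ' y).1 hy)
      (fun i _ => hg i) (by omega) hc
    refine valuation_prod_le_one _ _ fun i hi => ?_
    rw [Finset.mem_Ico] at hi
    refine (Valuation.map_sub _ _ _).trans (max_le (hE1 i hi.1 (by omega)) ?_)
    rw [map_mul, map_pow]
    exact mul_le_one' (hE1 (i + 1) (by omega) (by omega)) (pow_le_one' hc _)
  · have hg : ∀ i, 1 ≤ i → V.valuation (φ.coeff i) ≤ 1 := fun i hi => by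
      rw [hφ, monicGeneric_coeff]
      exact valuation_genericCoeff_le_one hV hi
    have hc : 1 < V.valuation y⁻¹ := by
      by_contra! h
      have h1 := valuation_ascending_le_one V.valuation (hE y hy) ((hZ' y).1 hy)
        hg (by omega) h 1 le_rfl (by omega)
      rw [← hφ0, hg0 y hy, Valuation.map_neg, map_mul] at ht
      exact absurd ht (not_lt.2 (mul_le_one' h h1))
    have ht' : V.valuation (algebraMap _ _ (varT Fq r)) ^ q ^ (r - 1) =
        V.valuation y⁻¹ ^ ∑ l ∈ Finset.range r, q ^ l := by
      have h1 := (valuation_ascending_pow_eq V.valuation (hE y hy) ((hZ' y).1 hy) hg (by omega) hc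
        1 le_rfl (r - 1) (by omega)).1
      rw [← hφ0, hg0 y hy, Valuation.map_neg, map_mul, mul_pow, h1, ← pow_add, add_comm,
        ← Finset.sum_range_succ, Nat.sub_add_cancel (by omega)]
    -- Values are compared after raising to the power q^(r-1), where v(T) and the values of the
    -- target coefficients become integral powers of v(c).
    refine (pow_left_inj₀ zero_le zero_le (n := q ^ (r - 1)) (by positivity)).1 ?_
    rw [← pow_mul, mul_comm w, pow_mul, ht', ← pow_mul,
      ← sum_mul_weightCorank hq (by omega) he hw, map_prod, ← Finset.prod_pow_eq_pow_sum,
      ← Finset.prod_pow]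
    refine Finset.prod_congr rfl fun i hi => ?_
    rw [Finset.mem_Ico] at hi
    rw [map_pow, ← pow_mul, mul_comm (e i), pow_mul, valuation_target_ascending_pow V.valuation
      (hE y hy) ((hZ' y).1 hy) hg hq hc i hi.1 hi.2, ← pow_mul]

end Main

end DrinfeldModule
end

theorem theorem1p1 {Fq : Type*} [Field Fq] [Fintype Fq] (q : ℕ) (hq : q = Fintype.card Fq)
    (r : ℕ) (hr : 2 ≤ r) (e : ℕ → ℕ)
    (he : ∑ i ∈ Finset.Ico 1 r, e i * (q ^ i - 1) = e r * (q ^ r - 1))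
    (ψ : ℕ) (hψ : ψ = (q ^ r - 1) / (q - 1))
    (s : ℕ) (w : ℤ)
    (hsw : (s = 1 ∧ w = DrinfeldModule.weightOne q r e) ∨
      (s = r - 1 ∧ w = DrinfeldModule.weightCorank q r e)) :
    ∃ P : (DrinfeldModule.CoeffRing Fq r)[X],
      P.map (algebraMap (DrinfeldModule.CoeffRing Fq r) (DrinfeldModule.GenericField Fq r)) =
        (DrinfeldModule.monicGeneric Fq r hr).modularPolynomial
          (DrinfeldModule.evalMonomial e) X (DrinfeldModule.standardSubmodule X r s) ∧
      P.natDegree = ψ ∧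
      P.coeff 0 ≠ 0 ∧
      (DrinfeldModule.degT (P.coeff 0) : ℤ) = ψ * w ∧
      (∀ k ≤ ψ, (DrinfeldModule.degT (P.coeff k) : ℤ) ≤ ((ψ : ℤ) - k) * w) ∧
      (DrinfeldModule.height P : ℤ) = ψ * w := by
  subst hq
  have hq : 1 < Fintype.card Fq := Fintype.one_lt_card
  have hsum : ∑ l ∈ Finset.range r, Fintype.card Fq ^ l = ψ := by
    rw [hψ, Nat.geomSum_eq hq]
  have hw0 : 0 ≤ w := by
    rcases hsw with ⟨-, rfl⟩ | ⟨-, rfl⟩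
    · exact DrinfeldModule.weightOne_nonneg hq (by omega) he
    · exact DrinfeldModule.weightCorank_nonneg hq (by omega)
  -- The weight is used as an exponent of v(T), hence must be a natural number.
  lift w to ℕ using hw0
  have hmain : ∃ P : (DrinfeldModule.CoeffRing Fq r)[X],
      P.map (algebraMap (DrinfeldModule.CoeffRing Fq r) (DrinfeldModule.GenericField Fq r)) =
        (DrinfeldModule.monicGeneric Fq r hr).modularPolynomial
          (DrinfeldModule.evalMonomial e) X (DrinfeldModule.standardSubmodule X r s) ∧
      P.natDegree = ψ ∧ P.coeff 0 ≠ 0 ∧ DrinfeldModule.degT (P.coeff 0) = ψ * w ∧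
      (∀ k ≤ ψ, DrinfeldModule.degT (P.coeff k) ≤ (ψ - k) * w) ∧
      DrinfeldModule.height P = ψ * w := by
    rcases hsw with ⟨rfl, hw⟩ | ⟨rfl, hw⟩
    · have h := DrinfeldModule.exists_modularPolynomial_one hr he hw
      rwa [hsum] at h
    · have h := DrinfeldModule.exists_modularPolynomial_corank_one hr he hw
      rwa [hsum] at h
  obtain ⟨P, h1, h2, h3, h4, h5, h6⟩ := hmain
  refine ⟨P, h1, h2, h3, by exact_mod_cast h4, fun k hk => ?_, by exact_mod_cast h6⟩
  rw [← Nat.cast_sub hk]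
  exact_mod_cast h5 k hk
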